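/- **Modified Talagrand inequality.** Let $n\ge 1$ and $m\ge 2$ be integers, let $(\mathcal S,\mathcal A)$ be a measurable space, and let $X_{ij}$ ($1\le i\le n$, $1\le j\le m$) be i.i.d. $\mathcal S$-valued random variables (independent over all pairs $(i,j)$, with a common distribution). Let $\mathcal F$ be a nonempty countable class of measurable functions $f=(f_1,\dots,f_n):\mathcal S\times\mathcal S\to\mathbb R^n$ such that $\sup_{z\in\mathcal S\times\mathcal S}|f_i(z)|\le U<\infty$ and $\mathbb E[f_i(X_{i1},X_{i2})]=0$ for all $f\in\mathcal F$ and all $i=1,\dots,n$. Set $$S_n:=\sup_{f\in\mathcal F}\left|\sum_{i=1}^n\sum_{1\le j\ne k\le m}f_i(X_{ij},X_{ik})\right|,\qquad \tilde S_n:=\sup_{f\in\mathcal F}\left|\sum_{i=1}^n\sum_{j=1}^{\lfloor m/2\rfloor}f_i\bigl(X_{ij},X_{i(\lfloor m/2\rfloor+j)}\bigr)\right|,$$ and let $\sigma^2$ satisfy, for every $f\in\mathcal F$, $$U^2\ \ge\ \sigma^2\ \ge\ \frac1{n\lfloor m/2\rfloor}\sum_{i=1}^n\sum_{j=1}^{\lfloor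 m/2\rfloor}\mathbb E\left[f_i^2\bigl(X_{ij},X_{i(\lfloor m/2\rfloor+j)}\bigr)\right].$$ Then, for any $x\ge 0$ and any $\alpha>0$, with probability at least $1-e^{-x}$, $$\frac{1}{nm(m-1)}\,S_n\ \le\ (1+\alpha)\,\mathbb E\left[\frac{\tilde S_n}{n\lfloor m/2\rfloor}\right]+\sqrt{\frac{2\sigma^2}{n\lfloor m/2\rfloor}\,x}+\left(\frac32+\frac1\alpha\right)\frac{Ux}{n\lfloor m/2\rfloor}.$$ -/

import Mathlib

open MeasureTheory ProbabilityTheory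

/-- The position `j` (of the first `⌊m/2⌋` ones) as an element of `{0, …, m - 1}`. -/
def firstHalf {m : ℕ} (j : Fin (m / 2)) : Fin m :=
  ⟨j.1, lt_of_lt_of_le j.2 (Nat.div_le_self m 2)⟩

/-- The position `⌊m/2⌋ + j` as an element of `{0, …, m - 1}`. -/
def secondHalf {m : ℕ} (j : Fin (m / 2)) : Fin m :=
  ⟨m / 2 + j.1, by have := j.2; omega⟩

/-- `S_n(ω) = sup_{f ∈ F} |∑_i ∑_{j ≠ k} f_i(X_{ij}(ω), X_{ik}(ω))|`. -/
noncomputable def uStatSup {Ω S : Type*} {n m : ℕ} (F : Set (S × S → Fin n → ℝ))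
    (X : Fin n → Fin m → Ω → S) (ω : Ω) : ℝ :=
  ⨆ f : F, |∑ i : Fin n, ∑ p ∈ (Finset.univ : Finset (Fin m)).offDiag,
    f.1 (X i p.1 ω, X i p.2 ω) i|

/-- `S̃_n(ω) = sup_{f ∈ F} |∑_i ∑_{j ≤ ⌊m/2⌋} f_i(X_{ij}(ω), X_{i(⌊m/2⌋ + j)}(ω))|`. -/
noncomputable def splitSup {Ω S : Type*} {n m : ℕ} (F : Set (S × S → Fin n → ℝ))
    (X : Fin n → Fin m → Ω → S) (ω : Ω) : ℝ :=
  ⨆ f : F, |∑ i : Fin n, ∑ j : Fin (m / 2),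
    f.1 (X i (firstHalf j) ω, X i (secondHalf j) ω) i|

/-!
The proof has two independent halves.

*Decoupling.* The average of `f_i (X_{ij}, X_{ik})` over `j ≠ k` is the average, over all
permutations `π` of the second index, of `f_i (X_{i π(a)}, X_{i π(b)})` for any fixed `a ≠ b`. Using
this for the disjoint pairs `(j, ⌊m/2⌋ + j)` bounds the normalized `S_n` by the average over `π` of
normalized copies of `S̃_n` built from the permuted variables (`uStatSup_le`). Each copy has the law
of `S̃_n` (`map_permPair`), so by Jensen's inequality every exponential moment bound for `S̃_n`
holds for `S_n` too (`integral_exp_average_le`), and it remains to bound the moment generating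
function of the supremum `S̃_n` of sums of independent centred variables.

*Concentration.* Rescale the functions to be bounded by `1`, let `Z` be the supremum and `V` a bound
on the variances of the sums. The entropy method is used in the following form. By tensorization
(`entropy_le_sum_coordAvg`), the entropy of `exp (t Z)` is at most the sum of its mean entropies in
each coordinate. The variables are not identically distributed, in that the functions `f_i` depend
on `i`, so comparing `Z` in the `k`-th coordinate with the maximizer of the sum that omits `k` would
lead to a different function for every `k`, whose variances do not add up to at most `V`. Instead,
the entropy in the `k`-th coordinate is bounded, for every member `s` of the family, in terms of the
variance of its `k`-th function and of the distance `d` between the part of `s` that does not depend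
on that coordinate and its maximum over the family. The bounds are then averaged over `s = τ`, the
maximizer of the whole sum, with weight `exp (t Z)` (`entropy_exp_max_le`). The same `τ` serves in
all coordinates, and summation gives
`Ent (exp (t Z)) ≤ t² (V / 2 * E exp (t Z) + E (Z exp (t Z)))` (`entropy_exp_max_pi_le`).
Integrating this differential inequality (`mgf_le_of_entropy_le`) yields, for `0 < t < 1`,
`log E exp (t Z) ≤ (t E Z + t² V / 2) / (1 - t)`, which says that `Z - E Z` is sub-gamma with
variance factor `V + 2 E Z` and scale `1`. Optimizing in `t` bounds `Z` by
`E Z + √(2 (V + 2 E Z) x) + x`, up to probability `exp (-x)`, and `√(4 x E Z) ≤ α E Z + x / α`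
(`one_sub_exp_neg_le_measureReal_le`).
-/

/-! ### Averaging over one coordinate of a product space -/

section Tensorization

variable {ι : Type*} [DecidableEq ι] {E : ι → Type*} [∀ i, MeasurableSpace (E i)]
  (μ : ∀ i, Measure (E i))

/-- The average of `f` over its `k`-th coordinate, as a function of all the coordinates
(constant in the `k`-th one). -/
noncomputable def coordAvg (k : ι) (f : (∀ i, E i) → ℝ) (x : ∀ i, E i) : ℝ :=
  ∫ z, f (Function.update x k z) ∂μ k

lemma measurable_update_prod (k : ι) :
    Measurable (fun p : (∀ i, E i) × E k => Function.update p.1 k p.2) := by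
  rw [measurable_pi_iff]
  intro i
  by_cases h : i = k
  · subst h
    simpa using measurable_snd
  · simp only [Function.update_of_ne h]
    exact (measurable_pi_apply i).comp measurable_fst

lemma coordAvg_update (k : ι) (f : (∀ i, E i) → ℝ) (x : ∀ i, E i) (z : E k) :
    coordAvg μ k f (Function.update x k z) = coordAvg μ k f x := by
  simp [coordAvg]

variable [∀ i, IsProbabilityMeasure (μ i)]

lemma Measurable.coordAvg {f : (∀ i, E i) → ℝ} (hf : Measurable f) (k : ι) :
    Measurable (coordAvg μ k f) :=
  ((hf.comp (measurable_update_prod k)).stronglyMeasurable.integral_prod_right').measurable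

lemma coordAvg_mem_Icc {f : (∀ i, E i) → ℝ} (hf : Measurable f) {a b : ℝ}
    (h : ∀ x, f x ∈ Set.Icc a b) (k : ι) (x : ∀ i, E i) : coordAvg μ k f x ∈ Set.Icc a b := by
  have hm : Measurable fun z => f (Function.update x k z) := hf.comp (measurable_update x)
  have hi : Integrable (fun z => f (Function.update x k z)) (μ k) :=
    Integrable.of_mem_Icc a b hm.aemeasurable (.of_forall fun z => h _)
  constructor
  · simpa [coordAvg] using
      integral_mono (integrable_const a) hi fun z => (h (Function.update x k z)).1
  · simpa [coordAvg] using
      integral_mono hi (integrable_const b) fun z => (h (Function.update x k z)).2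

variable [Fintype ι]

/-- Resampling one coordinate preserves the product measure. -/
lemma measurePreserving_update_prod (k : ι) :
    MeasurePreserving (fun p : (∀ i, E i) × E k => Function.update p.1 k p.2)
      ((Measure.pi μ).prod (μ k)) (Measure.pi μ) := by
  refine ⟨measurable_update_prod k, ?_⟩
  symm
  refine Measure.pi_eq fun s hs => ?_
  rw [Measure.map_apply (measurable_update_prod k) (MeasurableSet.univ_pi hs)]
  have : (fun p : (∀ i, E i) × E k => Function.update p.1 k p.2) ⁻¹' Set.univ.pi s
      = (Set.univ.pi (Function.update s k Set.univ)) ×ˢ s k := by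
    ext ⟨x, z⟩
    simp only [Set.mem_preimage, Set.mem_univ_pi, Set.mem_prod]
    constructor
    · intro h
      refine ⟨fun i => ?_, by simpa using h k⟩
      by_cases hi : i = k
      · subst hi; simp
      · simpa [Function.update_of_ne hi] using h i
    · rintro ⟨h, hz⟩ i
      by_cases hi : i = k
      · subst hi; simpa using hz
      · simpa [Function.update_of_ne hi] using h i
  rw [this, Measure.prod_prod, Measure.pi_pi, ← Finset.prod_erase_mul _ _ (Finset.mem_univ k),
    ← Finset.prod_erase_mul (f := fun i => μ i (s i)) _ (Finset.mem_univ k)]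
  congr 1
  simp only [Function.update_self, measure_univ, mul_one]
  refine Finset.prod_congr rfl fun i hi => ?_
  rw [Function.update_of_ne (Finset.ne_of_mem_erase hi)]

lemma integral_coordAvg {f : (∀ i, E i) → ℝ} (hf : Integrable f (Measure.pi μ)) (k : ι) :
    ∫ x, coordAvg μ k f x ∂Measure.pi μ = ∫ x, f x ∂Measure.pi μ := by
  have h := measurePreserving_update_prod μ k
  have h1 : Integrable (fun p : (∀ i, E i) × E k => f (Function.update p.1 k p.2))
      ((Measure.pi μ).prod (μ k)) := h.integrable_comp_of_integrable hf
  unfold coordAvg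
  rw [← integral_prod _ h1, ← integral_map h.measurable.aemeasurable, h.map_eq]
  rw [h.map_eq]; exact hf.aestronglyMeasurable

/-! ### Tensorization of the entropy -/

lemma integrable_mul_log {Ω : Type*} [MeasurableSpace Ω] (P : Measure Ω) [IsFiniteMeasure P]
    {f h : Ω → ℝ} (hf : Measurable f) (hh : Measurable h) {a b : ℝ} (ha : 0 < a)
    (hfab : ∀ x, f x ∈ Set.Icc a b) (hhab : ∀ x, h x ∈ Set.Icc a b) :
    Integrable (fun x => f x * Real.log (h x)) P := by
  have h1 : Integrable (fun x => Real.log (h x)) P :=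
    Integrable.of_mem_Icc (Real.log a) (Real.log b) hh.log.aemeasurable
      (.of_forall fun x => ⟨Real.log_le_log ha (hhab x).1,
        Real.log_le_log (ha.trans_le (hhab x).1) (hhab x).2⟩)
  refine h1.bdd_mul (c := b) hf.aestronglyMeasurable (.of_forall fun x => ?_)
  rw [Real.norm_eq_abs, abs_of_pos (ha.trans_le (hfab x).1)]
  exact (hfab x).2

/-- Gibbs' variational principle, averaged over the other coordinates: the entropy of `f` in its
`k`-th coordinate dominates what any other positive density `g` gives. -/
lemma integral_mul_log_sub_log_coordAvg_le {f g : (∀ i, E i) → ℝ} (hf : Measurable f)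
    (hg : Measurable g) {a b : ℝ} (ha : 0 < a) (hfab : ∀ x, f x ∈ Set.Icc a b)
    (hgab : ∀ x, g x ∈ Set.Icc a b) (k : ι) :
    ∫ x, f x * (Real.log (g x) - Real.log (coordAvg μ k g x)) ∂Measure.pi μ
      ≤ ∫ x, f x * (Real.log (f x) - Real.log (coordAvg μ k f x)) ∂Measure.pi μ := by
  have hAf := coordAvg_mem_Icc μ hf hfab k
  have hAg := coordAvg_mem_Icc μ hg hgab k
  have mAf := hf.coordAvg μ k
  have mAg := hg.coordAvg μ k
  have hint : ∀ {h : (∀ i, E i) → ℝ}, Measurable h → (∀ x, h x ∈ Set.Icc a b) →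
      Integrable (fun x => f x * Real.log (h x)) (Measure.pi μ) := fun hh hhab =>
    integrable_mul_log (Measure.pi μ) hf hh ha hfab hhab
  have i1 : Integrable (fun x => f x * (Real.log (g x) - Real.log (coordAvg μ k g x)))
      (Measure.pi μ) := by
    simpa only [mul_sub, Pi.sub_def] using (hint hg hgab).sub (hint mAg hAg)
  have i2 : Integrable (fun x => f x * (Real.log (f x) - Real.log (coordAvg μ k f x)))
      (Measure.pi μ) := by
    simpa only [mul_sub, Pi.sub_def] using (hint hf hfab).sub (hint mAf hAf)
  have if' : Integrable f (Measure.pi μ) :=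
    Integrable.of_mem_Icc a b hf.aemeasurable (.of_forall hfab)
  have ig : Integrable g (Measure.pi μ) :=
    Integrable.of_mem_Icc a b hg.aemeasurable (.of_forall hgab)
  -- the ratio `Af / Ag` is itself an average, so it can be moved out of the average of `g`
  have iq : Integrable (fun x => g x * (coordAvg μ k f x / coordAvg μ k g x)) (Measure.pi μ) := by
    refine ig.mul_bdd (c := b / a) (mAf.div mAg).aestronglyMeasurable (.of_forall fun x => ?_)
    have h1 := hAf x
    have h2 := hAg x
    rw [Real.norm_eq_abs, abs_of_pos (div_pos (ha.trans_le h1.1) (ha.trans_le h2.1))]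
    exact div_le_div₀ (ha.le.trans (h1.1.trans h1.2)) h1.2 ha h2.1
  have hq : ∫ x, g x * (coordAvg μ k f x / coordAvg μ k g x) ∂Measure.pi μ
      = ∫ x, f x ∂Measure.pi μ := by
    rw [← integral_coordAvg μ iq k, ← integral_coordAvg μ if' k]
    refine integral_congr_ae (.of_forall fun x => ?_)
    have h2 : coordAvg μ k g x ≠ 0 := (ha.trans_le (hAg x).1).ne'
    change coordAvg μ k (fun y => g y * (coordAvg μ k f y / coordAvg μ k g y)) x = _
    rw [coordAvg]
    simp only [coordAvg_update]
    rw [integral_mul_const]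
    change coordAvg μ k g x * _ = _
    field_simp
  have key : ∫ x, f x * (Real.log (g x) - Real.log (coordAvg μ k g x)) ∂Measure.pi μ
      - ∫ x, f x * (Real.log (f x) - Real.log (coordAvg μ k f x)) ∂Measure.pi μ
      ≤ ∫ x, g x * (coordAvg μ k f x / coordAvg μ k g x) ∂Measure.pi μ
        - ∫ x, f x ∂Measure.pi μ := by
    rw [← integral_sub i1 i2, ← integral_sub iq if']
    refine integral_mono (i1.sub i2) (iq.sub if') fun x => ?_
    have pf := ha.trans_le (hfab x).1
    have pg := ha.trans_le (hgab x).1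
    have pAf := ha.trans_le (hAf x).1
    have pAg := ha.trans_le (hAg x).1
    have h := Real.log_le_sub_one_of_pos
      (show 0 < g x * coordAvg μ k f x / (f x * coordAvg μ k g x) by positivity)
    rw [Real.log_div (by positivity) (by positivity), Real.log_mul pg.ne' pAf.ne',
      Real.log_mul pf.ne' pAg.ne'] at h
    calc _ = f x * (Real.log (g x) + Real.log (coordAvg μ k f x)
            - (Real.log (f x) + Real.log (coordAvg μ k g x))) := by ring
      _ ≤ f x * (g x * coordAvg μ k f x / (f x * coordAvg μ k g x) - 1) :=
          mul_le_mul_of_nonneg_left h pf.le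
      _ = _ := by field_simp
  linarith

/-- Subadditivity of the entropy on a product space. -/
theorem entropy_le_sum_coordAvg {f : (∀ i, E i) → ℝ} (hf : Measurable f) {a b : ℝ} (ha : 0 < a)
    (hfab : ∀ x, f x ∈ Set.Icc a b) :
    ∫ x, f x * Real.log (f x) ∂Measure.pi μ
        - (∫ x, f x ∂Measure.pi μ) * Real.log (∫ x, f x ∂Measure.pi μ)
      ≤ ∑ k, ∫ x, f x * (Real.log (f x) - Real.log (coordAvg μ k f x)) ∂Measure.pi μ := by
  have hint : ∀ {h : (∀ i, E i) → ℝ}, Measurable h → (∀ x, h x ∈ Set.Icc a b) →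
      Integrable (fun x => f x * Real.log (h x)) (Measure.pi μ) := fun hh hhab =>
    integrable_mul_log (Measure.pi μ) hf hh ha hfab hhab
  -- `g` is `f` averaged over the coordinates in `s`
  have main : ∀ s : Finset ι, ∃ g : (∀ i, E i) → ℝ, Measurable g ∧ (∀ x, g x ∈ Set.Icc a b) ∧
      (∫ x, g x ∂Measure.pi μ = ∫ x, f x ∂Measure.pi μ) ∧
      (∀ i ∈ s, ∀ x z, g (Function.update x i z) = g x) ∧
      ∫ x, f x * Real.log (f x) ∂Measure.pi μ - ∫ x, f x * Real.log (g x) ∂Measure.pi μ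
        ≤ ∑ k ∈ s, ∫ x, f x * (Real.log (f x) - Real.log (coordAvg μ k f x)) ∂Measure.pi μ := by
    intro s
    induction s using Finset.induction_on with
    | empty => exact ⟨f, hf, hfab, rfl, by simp, by simp⟩
    | insert k s hk ih =>
      obtain ⟨g, hg, hgab, hgi, hginv, hgs⟩ := ih
      have hAg := coordAvg_mem_Icc μ hg hgab k
      refine ⟨coordAvg μ k g, hg.coordAvg μ k, hAg, ?_, ?_, ?_⟩
      · rw [integral_coordAvg μ
          (Integrable.of_mem_Icc a b hg.aemeasurable (.of_forall hgab)), hgi]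
      · intro i hi x z
        by_cases hik : i = k
        · subst hik; exact coordAvg_update μ i g x z
        · have his : i ∈ s := Finset.mem_of_mem_insert_of_ne hi hik
          unfold coordAvg
          refine integral_congr_ae (.of_forall fun w => ?_)
          change g (Function.update (Function.update x i z) k w) = g (Function.update x k w)
          rw [Function.update_comm hik, hginv i his]
      · rw [Finset.sum_insert hk]
        have h := integral_mul_log_sub_log_coordAvg_le μ hf hg ha hfab hgab k
        simp only [mul_sub] at h ⊢
        rw [integral_sub (hint hg hgab) (hint (hg.coordAvg μ k) hAg)] at h
        simp only [mul_sub] at hgs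
        linarith
  obtain ⟨g, hg, hgab, hgi, hginv, hgs⟩ := main Finset.univ
  -- averaged over all the coordinates, `g` is constant
  have hconst : ∀ x y, g x = g y := by
    intro x y
    have : ∀ s : Finset ι, g (fun i => if i ∈ s then y i else x i) = g x := by
      intro s
      induction s using Finset.induction_on with
      | empty => simp
      | insert k s hk ih =>
        rw [← ih, ← hginv k (Finset.mem_univ k) (fun i => if i ∈ s then y i else x i) (y k)]
        congr 1
        funext i
        by_cases hik : i = k
        · subst hik; simp
        · simp [hik]
    simpa using (this Finset.univ).symm
  have hne : Nonempty (∀ i, E i) := (Measure.pi μ).nonempty_of_neZero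
  have hg0 : ∀ x, g x = ∫ x, f x ∂Measure.pi μ := by
    intro x
    rw [← hgi, integral_congr_ae (.of_forall fun y => hconst y x)]
    simp
  simp only [hg0, integral_mul_const] at hgs
  exact hgs

end Tensorization

/-! ### Entropy of a maximum in one coordinate -/

lemma mul_exp_sub_exp_add_one_le_of_nonneg {s : ℝ} (hs : 0 ≤ s) :
    s * Real.exp s - Real.exp s + 1 ≤ s ^ 2 * Real.exp s / 2 := by
  have hmono : MonotoneOn
      (fun s : ℝ => s ^ 2 * Real.exp s / 2 - (s * Real.exp s - Real.exp s + 1)) (Set.Ici 0) := by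
    have hd : ∀ s : ℝ, HasDerivAt
        (fun s : ℝ => s ^ 2 * Real.exp s / 2 - (s * Real.exp s - Real.exp s + 1))
        (s ^ 2 * Real.exp s / 2) s := by
      intro s
      have h1 := (((hasDerivAt_pow 2 s).mul (Real.hasDerivAt_exp s)).div_const 2).sub
        ((((hasDerivAt_id s).mul (Real.hasDerivAt_exp s)).sub (Real.hasDerivAt_exp s)).add_const 1)
      refine h1.congr_deriv ?_
      simp; ring
    refine monotoneOn_of_deriv_nonneg (convex_Ici 0)
      (fun s _ => (hd s).continuousAt.continuousWithinAt)
      (fun s _ => (hd s).differentiableAt.differentiableWithinAt) fun s _ => ?_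
    rw [(hd s).deriv]; positivity
  have := hmono Set.self_mem_Ici hs hs
  simp at this
  linarith

lemma mul_exp_sub_exp_add_one_le_of_nonpos {s : ℝ} (hs : s ≤ 0) :
    s * Real.exp s - Real.exp s + 1 ≤ s ^ 2 / 2 := by
  have hanti : AntitoneOn
      (fun s : ℝ => s ^ 2 / 2 - (s * Real.exp s - Real.exp s + 1)) (Set.Iic 0) := by
    have hd : ∀ s : ℝ, HasDerivAt
        (fun s : ℝ => s ^ 2 / 2 - (s * Real.exp s - Real.exp s + 1))
        (s * (1 - Real.exp s)) s := by
      intro s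
      have h1 := ((hasDerivAt_pow 2 s).div_const 2).sub
        ((((hasDerivAt_id s).mul (Real.hasDerivAt_exp s)).sub (Real.hasDerivAt_exp s)).add_const 1)
      refine h1.congr_deriv ?_
      simp; ring
    refine antitoneOn_of_deriv_nonpos (convex_Iic 0)
      (fun s _ => (hd s).continuousAt.continuousWithinAt)
      (fun s _ => (hd s).differentiableAt.differentiableWithinAt) fun s hs => ?_
    rw [(hd s).deriv]
    simp only [interior_Iic, Set.mem_Iio] at hs
    exact mul_nonpos_of_nonpos_of_nonneg hs.le (by linarith [Real.exp_le_one_iff.2 hs.le])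
  have := hanti hs Set.self_mem_Iic hs
  simp at this
  linarith

/-- The bound in `u ≤ 1` that the variance proxy and the increment have to satisfy. The quantity
`y` plays the role of a centred variable, which `u` exceeds up to the error `d`; the terms linear
in `y` and `u` are there because of their known signs in the mean. -/
lemma mul_exp_sub_exp_add_one_le {t u y d : ℝ} (ht : 0 ≤ t) (hu : u ≤ 1) (hy : y ≤ 1)
    (huy : y - d ≤ u) :
    t * u * Real.exp (t * u) - Real.exp (t * u) + 1
      ≤ t ^ 2 / 2 * y ^ 2 + t ^ 2 * (u * Real.exp (t * u) - y + d) - t ^ 2 / 2 * d * (u + y) := by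
  have h1 : t * u * Real.exp (t * u) - Real.exp (t * u) + 1
      ≤ t ^ 2 / 2 * u ^ 2 + t ^ 2 * (u * (Real.exp (t * u) - 1)) := by
    rcases le_total 0 u with h0 | h0
    · have h := mul_exp_sub_exp_add_one_le_of_nonneg (mul_nonneg ht h0)
      have he : 0 ≤ Real.exp (t * u) - 1 := by
        linarith [Real.one_le_exp (mul_nonneg ht h0)]
      have h2 : u ^ 2 * (Real.exp (t * u) - 1) ≤ u * (Real.exp (t * u) - 1) :=
        mul_le_mul_of_nonneg_right (by nlinarith) he
      have h3 := mul_le_mul_of_nonneg_left h2 (sq_nonneg t)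
      have h4 : 0 ≤ t ^ 2 * (u ^ 2 * (Real.exp (t * u) - 1)) := by positivity
      linarith
    · have h := mul_exp_sub_exp_add_one_le_of_nonpos (mul_nonpos_of_nonneg_of_nonpos ht h0)
      have he : Real.exp (t * u) - 1 ≤ 0 := by
        linarith [Real.exp_le_one_iff.2 (mul_nonpos_of_nonneg_of_nonpos ht h0)]
      have := mul_nonneg (sq_nonneg t) (mul_nonneg_of_nonpos_of_nonpos h0 he)
      linarith
  have h2 : 0 ≤ t ^ 2 / 2 * ((u - y + d) * (2 - (u + y))) :=
    mul_nonneg (by positivity) (mul_nonneg (by linarith) (by linarith))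
  linarith

/-- Entropy bound for the exponential of `Z z = max_s (c s + g s z)`, the maximum being attained at
`s = τ z`. It involves the variance and the value of the maximizing function `g (τ z)` itself,
rather than those of a function that maximizes the remaining part `c`; this is what later allows to
add up the bounds over coordinates with different distributions. -/
lemma entropy_exp_max_le {E T : Type*} [MeasurableSpace E] (μ : Measure E) [IsProbabilityMeasure μ]
    [Finite T] [Nonempty T] [MeasurableSpace T] [MeasurableSingletonClass T]
    (c : T → ℝ) (g : T → E → ℝ) (hg : ∀ s, Measurable (g s)) (hg1 : ∀ s z, |g s z| ≤ 1)
    (hg0 : ∀ s, ∫ z, g s z ∂μ = 0) (τ : E → T) (hτ : Measurable τ) (Z : E → ℝ)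
    (hZ : ∀ z, Z z = c (τ z) + g (τ z) z) (hmax : ∀ s z, c s + g s z ≤ Z z)
    {t : ℝ} (ht : 0 ≤ t) :
    ∫ z, Real.exp (t * Z z) * (t * Z z) ∂μ
        - (∫ z, Real.exp (t * Z z) ∂μ) * Real.log (∫ z, Real.exp (t * Z z) ∂μ)
      ≤ ∫ z, Real.exp (t * Z z) *
          (t ^ 2 / 2 * (∫ w, g (τ z) w ^ 2 ∂μ) + t ^ 2 * g (τ z) z) ∂μ := by
  obtain ⟨s₀, hs₀⟩ := Finite.exists_max c
  have hgle : ∀ s z, g s z ≤ 1 := fun s z => (abs_le.1 (hg1 s z)).2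
  have hgge : ∀ s z, -1 ≤ g s z := fun s z => (abs_le.1 (hg1 s z)).1
  have hcount : Countable T := inferInstance
  have hgτ : Measurable fun z => g (τ z) z :=
    (measurable_from_prod_countable_right (f := fun p : T × E => g p.1 p.2) hg).comp
      (hτ.prodMk measurable_id)
  have hcτ : Measurable fun z => c (τ z) := (measurable_of_countable c).comp hτ
  have hVτ : Measurable fun z => ∫ w, g (τ z) w ^ 2 ∂μ :=
    (measurable_of_countable fun s => ∫ w, g s w ^ 2 ∂μ).comp hτ
  have hZm : Measurable Z := by
    rw [show Z = _ from funext hZ]; exact hcτ.add hgτ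
  -- the increment due to the coordinate `z`; it lies between the centred variable `g s₀` and `1`
  set u : E → ℝ := fun z => Z z - c s₀ with hu
  have hum : Measurable u := hZm.sub_const _
  have hu1 : ∀ z, u z ≤ 1 := fun z => by
    simp only [hu]; linarith [hZ z, hs₀ (τ z), hgle (τ z) z]
  have hug : ∀ z, g s₀ z ≤ u z := fun z => by simp only [hu]; linarith [hmax s₀ z]
  have hu2 : ∀ z, -1 ≤ u z := fun z => (hgge s₀ z).trans (hug z)
  have hub : ∀ z, u z ∈ Set.Icc (-1) 1 := fun z => ⟨hu2 z, hu1 z⟩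
  have iu : Integrable u μ := .of_mem_Icc _ _ hum.aemeasurable (.of_forall hub)
  have ig : ∀ s, Integrable (g s) μ := fun s =>
    .of_mem_Icc (-1) 1 (hg s).aemeasurable (.of_forall fun z => ⟨hgge s z, hgle s z⟩)
  have ig2 : ∀ s, Integrable (fun z => g s z ^ 2) μ := fun s =>
    .of_mem_Icc 0 1 ((hg s).pow_const 2).aemeasurable (.of_forall fun z =>
      ⟨sq_nonneg _, (sq_le_one_iff_abs_le_one _).2 (hg1 s z)⟩)
  have hu0 : 0 ≤ ∫ z, u z ∂μ := by
    rw [← hg0 s₀]; exact integral_mono (ig s₀) iu hug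
  set q := Real.exp (t * c s₀) with hq
  have hq0 : 0 < q := Real.exp_pos _
  have hF : ∀ z, Real.exp (t * Z z) = q * Real.exp (t * u z) := fun z => by
    rw [hq, ← Real.exp_add]; congr 1; simp only [hu]; ring
  have ieu : Integrable (fun z => Real.exp (t * u z)) μ := by
    refine .of_mem_Icc 0 (Real.exp t) (hum.const_mul t).exp.aemeasurable (.of_forall fun z =>
      ⟨(Real.exp_pos _).le, Real.exp_le_exp.2 ?_⟩)
    nlinarith [hu1 z]
  have hbdd : ∀ {h : E → ℝ} (_ : Measurable h) (C : ℝ), (∀ z, |h z| ≤ C) →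
      Integrable (fun z => Real.exp (t * u z) * h z) μ := fun {h} hh C hC =>
    ieu.mul_bdd (c := C) hh.aestronglyMeasurable (.of_forall hC)
  have ieuu : Integrable (fun z => Real.exp (t * u z) * u z) μ :=
    hbdd hum 1 fun z => abs_le.2 (hub z)
  set A := ∫ z, Real.exp (t * u z) ∂μ with hA
  set B := ∫ z, Real.exp (t * u z) * u z ∂μ with hB
  have hA1 : 1 ≤ A := by
    have : ∫ z, (1 + t * u z) ∂μ ≤ A :=
      integral_mono ((integrable_const 1).add (iu.const_mul t)) ieu fun z => by
        simp only []; linarith [Real.add_one_le_exp (t * u z)]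
    rw [integral_add (integrable_const 1) (iu.const_mul t), integral_const_mul] at this
    simp at this
    nlinarith
  -- the entropy, computed with the reference value `q`
  have hent : t * B - A * Real.log A ≤ t * B - A + 1 := by
    have h := Real.one_sub_inv_le_log_of_pos (zero_lt_one.trans_le hA1)
    have h2 := mul_le_mul_of_nonneg_left h (zero_le_one.trans hA1)
    rw [mul_sub, mul_inv_cancel₀ (zero_lt_one.trans_le hA1).ne'] at h2
    linarith
  -- any `s` may be used to bound it: `u` exceeds the centred variable `g s` up to `c s₀ - c s`
  have hs : ∀ s, t * B - A + 1
      ≤ t ^ 2 * B + A * (t ^ 2 / 2 * (∫ w, g s w ^ 2 ∂μ) + t ^ 2 * (c s₀ - c s)) := by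
    intro s
    have hd : 0 ≤ c s₀ - c s := by linarith [hs₀ s]
    have i1 : Integrable (fun z => t * u z * Real.exp (t * u z) - Real.exp (t * u z) + 1) μ := by
      refine Integrable.add (Integrable.sub ?_ ieu) (integrable_const 1)
      refine (ieuu.const_mul t).congr (.of_forall fun z => ?_)
      ring
    have hV0 : 0 ≤ ∫ w, g s w ^ 2 ∂μ := integral_nonneg fun z => sq_nonneg _
    have i2a := (ig2 s).const_mul (t ^ 2 / 2)
    have i2b := ieuu.const_mul (t ^ 2)
    have i2c := (ig s).const_mul (-(t ^ 2) - t ^ 2 / 2 * (c s₀ - c s))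
    have i2d := iu.const_mul (-(t ^ 2 / 2 * (c s₀ - c s)))
    have i2e : Integrable (fun _ : E => t ^ 2 * (c s₀ - c s)) μ := integrable_const _
    have h : ∫ z, (t * u z * Real.exp (t * u z) - Real.exp (t * u z) + 1) ∂μ
        ≤ ∫ z, (t ^ 2 / 2 * g s z ^ 2 + t ^ 2 * (Real.exp (t * u z) * u z)
          + (-(t ^ 2) - t ^ 2 / 2 * (c s₀ - c s)) * g s z
          + (-(t ^ 2 / 2 * (c s₀ - c s))) * u z + t ^ 2 * (c s₀ - c s)) ∂μ := by
      refine integral_mono i1 ((((i2a.add i2b).add i2c).add i2d).add i2e) fun z => ?_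
      have h := mul_exp_sub_exp_add_one_le (d := c s₀ - c s) ht (hu1 z) (hgle s z)
        (by simp only [hu]; linarith [hmax s z])
      simp only []
      linarith
    have i3 : Integrable (fun z => t ^ 2 / 2 * g s z ^ 2 + t ^ 2 * (Real.exp (t * u z) * u z)) μ :=
      i2a.add i2b
    have i4 : Integrable (fun z => t ^ 2 / 2 * g s z ^ 2 + t ^ 2 * (Real.exp (t * u z) * u z)
        + (-(t ^ 2) - t ^ 2 / 2 * (c s₀ - c s)) * g s z) μ := i3.add i2c
    have i5 : Integrable (fun z => t ^ 2 / 2 * g s z ^ 2 + t ^ 2 * (Real.exp (t * u z) * u z)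
        + (-(t ^ 2) - t ^ 2 / 2 * (c s₀ - c s)) * g s z
        + (-(t ^ 2 / 2 * (c s₀ - c s))) * u z) μ := i4.add i2d
    rw [integral_add i5 i2e, integral_add i4 i2d, integral_add i3 i2c, integral_add i2a i2b] at h
    simp only [integral_const_mul, hg0 s, integral_const, probReal_univ, one_smul] at h
    have hl : ∫ z, (t * u z * Real.exp (t * u z) - Real.exp (t * u z) + 1) ∂μ = t * B - A + 1 := by
      have : ∀ z, t * u z * Real.exp (t * u z) = t * (Real.exp (t * u z) * u z) := fun z => by ring
      simp only [this]
      have i6 : Integrable (fun z => t * (Real.exp (t * u z) * u z) - Real.exp (t * u z)) μ :=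
        (ieuu.const_mul t).sub ieu
      rw [integral_add i6 (integrable_const 1),
        integral_sub (ieuu.const_mul t) ieu, integral_const_mul]
      simp [hA, hB]
    rw [hl] at h
    -- the linear term in `u` has a nonpositive mean, and the factor `A ≥ 1` is harmless
    have h1 : 0 ≤ t ^ 2 / 2 * (c s₀ - c s) * ∫ z, u z ∂μ := by positivity
    have h2 : 0 ≤ (A - 1) * (t ^ 2 / 2 * (∫ w, g s w ^ 2 ∂μ) + t ^ 2 * (c s₀ - c s)) :=
      mul_nonneg (by linarith) (by positivity)
    linarith
  -- average the bounds with weight `exp (t * u z)`, taking `s = τ z`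
  obtain ⟨D, hD⟩ := Finite.exists_max fun s =>
    |t ^ 2 / 2 * (∫ w, g s w ^ 2 ∂μ) + t ^ 2 * (c s₀ - c s)|
  have iV : Integrable (fun z => Real.exp (t * u z) *
      (t ^ 2 / 2 * (∫ w, g (τ z) w ^ 2 ∂μ) + t ^ 2 * (c s₀ - c (τ z)))) μ :=
    hbdd ((hVτ.const_mul _).add ((hcτ.const_sub _).const_mul _)) _ fun z => hD (τ z)
  have hfin : A * (t * B - A + 1) ≤ A * (∫ z, Real.exp (t * u z) *
      (t ^ 2 / 2 * (∫ w, g (τ z) w ^ 2 ∂μ) + t ^ 2 * g (τ z) z) ∂μ) := by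
    have h : ∫ z, Real.exp (t * u z) * (t * B - A + 1) ∂μ
        ≤ ∫ z, (t ^ 2 * B * Real.exp (t * u z) + A * (Real.exp (t * u z) *
          (t ^ 2 / 2 * (∫ w, g (τ z) w ^ 2 ∂μ) + t ^ 2 * (c s₀ - c (τ z))))) ∂μ := by
      refine integral_mono (ieu.mul_const _) ((ieu.const_mul _).add (iV.const_mul A)) fun z => ?_
      have := mul_le_mul_of_nonneg_left (hs (τ z)) (Real.exp_pos (t * u z)).le
      simp only []
      linarith
    rw [integral_mul_const, integral_add (ieu.const_mul _) (iV.const_mul A), integral_const_mul,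
      integral_const_mul] at h
    have h3 : ∫ z, Real.exp (t * u z) *
        (t ^ 2 / 2 * (∫ w, g (τ z) w ^ 2 ∂μ) + t ^ 2 * g (τ z) z) ∂μ
        = t ^ 2 * B + ∫ z, Real.exp (t * u z) *
          (t ^ 2 / 2 * (∫ w, g (τ z) w ^ 2 ∂μ) + t ^ 2 * (c s₀ - c (τ z))) ∂μ := by
      rw [hB, ← integral_const_mul, ← integral_add (ieuu.const_mul _) iV]
      refine integral_congr_ae (.of_forall fun z => ?_)
      simp only [hu, hZ z]
      ring
    rw [h3]
    linarith
  have hfin' := le_of_mul_le_mul_left hfin (zero_lt_one.trans_le hA1)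
  have e1 : ∫ z, Real.exp (t * Z z) ∂μ = q * A := by
    simp only [hF]; rw [integral_const_mul]
  have e2 : ∫ z, Real.exp (t * Z z) * (t * Z z) ∂μ = q * (t * B + t * c s₀ * A) := by
    have : ∀ z, Real.exp (t * Z z) * (t * Z z) = q * (t * (Real.exp (t * u z) * u z)
        + t * c s₀ * Real.exp (t * u z)) := fun z => by
      rw [hF]; simp only [hu]; ring
    simp only [this]
    rw [integral_const_mul, integral_add (ieuu.const_mul t) (ieu.const_mul _), integral_const_mul,
      integral_const_mul]
  have e3 : ∫ z, Real.exp (t * Z z) *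
      (t ^ 2 / 2 * (∫ w, g (τ z) w ^ 2 ∂μ) + t ^ 2 * g (τ z) z) ∂μ
      = q * ∫ z, Real.exp (t * u z) *
        (t ^ 2 / 2 * (∫ w, g (τ z) w ^ 2 ∂μ) + t ^ 2 * g (τ z) z) ∂μ := by
    simp only [hF, mul_assoc]; rw [integral_const_mul]
  rw [e1, e2, e3, Real.log_mul hq0.ne' (zero_lt_one.trans_le hA1).ne', hq, Real.log_exp, ← hq]
  have := mul_le_mul_of_nonneg_left (hent.trans hfin') hq0.le
  linarith

/-! ### Moment generating function of a maximum of sums -/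

/-- Entropy bound for the exponential of the maximum `Z` of a finite family of sums of independent
centred variables, where the family may depend on the coordinate. -/
lemma entropy_exp_max_pi_le {ι T : Type*} [Fintype ι] [DecidableEq ι] {E : ι → Type*}
    [∀ i, MeasurableSpace (E i)] (μ : ∀ i, Measure (E i)) [∀ i, IsProbabilityMeasure (μ i)]
    [Finite T] [Nonempty T] [MeasurableSpace T] [MeasurableSingletonClass T]
    (g : T → ∀ i, E i → ℝ) (hg : ∀ s i, Measurable (g s i)) (hg1 : ∀ s i z, |g s i z| ≤ 1)
    (hg0 : ∀ s i, ∫ z, g s i z ∂μ i = 0) (τ : (∀ i, E i) → T) (hτ : Measurable τ)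
    (Z : (∀ i, E i) → ℝ) (hZ : ∀ x, Z x = ∑ i, g (τ x) i (x i))
    (hmax : ∀ s x, ∑ i, g s i (x i) ≤ Z x) {V : ℝ} (hV : ∀ s, ∑ i, ∫ z, g s i z ^ 2 ∂μ i ≤ V)
    {t : ℝ} (ht : 0 ≤ t) :
    ∫ x, Real.exp (t * Z x) * (t * Z x) ∂Measure.pi μ
        - (∫ x, Real.exp (t * Z x) ∂Measure.pi μ) *
          Real.log (∫ x, Real.exp (t * Z x) ∂Measure.pi μ)
      ≤ t ^ 2 / 2 * V * (∫ x, Real.exp (t * Z x) ∂Measure.pi μ)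
        + t ^ 2 * ∫ x, Real.exp (t * Z x) * Z x ∂Measure.pi μ := by
  have hcount : Countable T := inferInstance
  have hgτ : ∀ k, Measurable fun x : ∀ i, E i => g (τ x) k (x k) := fun k =>
    (measurable_from_prod_countable_right (f := fun p : T × E k => g p.1 k p.2)
      (hg · k)).comp (hτ.prodMk (measurable_pi_apply k))
  have hVτ : ∀ k, Measurable fun x : ∀ i, E i => ∫ w, g (τ x) k w ^ 2 ∂μ k := fun k =>
    (measurable_of_countable fun s => ∫ w, g s k w ^ 2 ∂μ k).comp hτ
  have hZm : Measurable Z := by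
    rw [show Z = _ from funext hZ]; exact Finset.measurable_sum _ fun k _ => hgτ k
  set N : ℝ := ((Fintype.card ι : ℕ) : ℝ) with hN
  have hZN : ∀ x, |Z x| ≤ N := fun x => by
    rw [hZ]
    refine (Finset.abs_sum_le_sum_abs _ _).trans ?_
    simpa [hN] using Finset.sum_le_sum (s := Finset.univ) fun i _ => hg1 (τ x) i (x i)
  set f : (∀ i, E i) → ℝ := fun x => Real.exp (t * Z x) with hf
  have hfm : Measurable f := (hZm.const_mul t).exp
  have hfab : ∀ x, f x ∈ Set.Icc (Real.exp (-(t * N))) (Real.exp (t * N)) := fun x => by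
    have h := abs_le.1 (hZN x)
    exact ⟨Real.exp_le_exp.2 (by nlinarith), Real.exp_le_exp.2 (by nlinarith)⟩
  have ha : 0 < Real.exp (-(t * N)) := Real.exp_pos _
  have ifm : Integrable f (Measure.pi μ) :=
    .of_mem_Icc _ _ hfm.aemeasurable (.of_forall hfab)
  have hbdd : ∀ {h : (∀ i, E i) → ℝ} (_ : Measurable h) (C : ℝ), (∀ x, |h x| ≤ C) →
      Integrable (fun x => f x * h x) (Measure.pi μ) := fun {h} hh C hC =>
    ifm.mul_bdd (c := C) hh.aestronglyMeasurable (.of_forall hC)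
  have hV01 : ∀ s k, (∫ w, g s k w ^ 2 ∂μ k) ∈ Set.Icc (0 : ℝ) 1 := fun s k => by
    have h2 : ∀ w, g s k w ^ 2 ≤ 1 := fun w => (sq_le_one_iff_abs_le_one _).2 (hg1 s k w)
    refine ⟨integral_nonneg fun w => sq_nonneg _, ?_⟩
    have := integral_mono (μ := μ k) (.of_mem_Icc 0 1 ((hg s k).pow_const 2).aemeasurable
      (.of_forall fun z => ⟨sq_nonneg _, h2 z⟩)) (integrable_const 1) h2
    simpa using this
  -- the bound in one coordinate, integrated over the other ones
  have hk : ∀ k, ∫ x, f x * (Real.log (f x) - Real.log (coordAvg μ k f x)) ∂Measure.pi μ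
      ≤ ∫ x, f x * (t ^ 2 / 2 * (∫ w, g (τ x) k w ^ 2 ∂μ k) + t ^ 2 * g (τ x) k (x k))
        ∂Measure.pi μ := by
    intro k
    have hA := coordAvg_mem_Icc μ hfm hfab k
    have i1 := integrable_mul_log (Measure.pi μ) hfm hfm ha hfab hfab
    have i2 := integrable_mul_log (Measure.pi μ) hfm (hfm.coordAvg μ k) ha hfab hA
    have i3 : Integrable (fun x => f x * (t ^ 2 / 2 * (∫ w, g (τ x) k w ^ 2 ∂μ k)
        + t ^ 2 * g (τ x) k (x k))) (Measure.pi μ) := by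
      refine hbdd (((hVτ k).const_mul _).add ((hgτ k).const_mul _)) (t ^ 2 / 2 + t ^ 2) fun x => ?_
      have h1 := hV01 (τ x) k
      have h2 := abs_le.1 (hg1 (τ x) k (x k))
      rw [abs_le]
      have h3 := mul_le_mul_of_nonneg_left h1.2 (by positivity : 0 ≤ t ^ 2 / 2)
      have h4 := mul_nonneg (by positivity : 0 ≤ t ^ 2 / 2) h1.1
      have h5 := mul_le_mul_of_nonneg_left h2.1 (sq_nonneg t)
      have h6 := mul_le_mul_of_nonneg_left h2.2 (sq_nonneg t)
      constructor <;> nlinarith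
    have i4 : Integrable (fun x => f x * (Real.log (f x) - Real.log (coordAvg μ k f x)))
        (Measure.pi μ) := by
      simpa only [mul_sub, Pi.sub_def] using i1.sub i2
    rw [← integral_coordAvg μ i4 k, ← integral_coordAvg μ i3 k]
    have hI : ∀ {h : (∀ i, E i) → ℝ}, Measurable h → Integrable h (Measure.pi μ) →
        Integrable (coordAvg μ k h) (Measure.pi μ) := fun {h} hh hi => by
      have hmp := measurePreserving_update_prod μ k
      exact (hmp.integrable_comp_of_integrable hi).integral_prod_left
    refine integral_mono
      (hI (hfm.mul (hfm.log.sub (hfm.coordAvg μ k).log)) i4)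
      (hI (hfm.mul (((hVτ k).const_mul _).add ((hgτ k).const_mul _))) i3) fun x => ?_
    have hup : Measurable fun z => Function.update x k z := measurable_update x
    have hZu : ∀ s z, ∑ i, g s i (Function.update x k z i)
        = (∑ i ∈ Finset.univ.erase k, g s i (x i)) + g s k z := fun s z => by
      rw [← Finset.sum_erase_add _ _ (Finset.mem_univ k), Function.update_self]
      congr 1
      refine Finset.sum_congr rfl fun i hi => ?_
      rw [Function.update_of_ne (Finset.ne_of_mem_erase hi)]
    have h1 := entropy_exp_max_le (μ k) (fun s => ∑ i ∈ Finset.univ.erase k, g s i (x i))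
      (fun s => g s k) (hg · k) (hg1 · k) (hg0 · k) (fun z => τ (Function.update x k z))
      (hτ.comp hup) (fun z => Z (Function.update x k z))
      (fun z => by rw [hZ, hZu]) (fun s z => by rw [← hZu]; exact hmax _ _) ht
    have h2 : coordAvg μ k (fun x => f x * (Real.log (f x) - Real.log (coordAvg μ k f x))) x
        = ∫ z, Real.exp (t * Z (Function.update x k z)) * (t * Z (Function.update x k z)) ∂μ k
          - (∫ z, Real.exp (t * Z (Function.update x k z)) ∂μ k) *
            Real.log (∫ z, Real.exp (t * Z (Function.update x k z)) ∂μ k) := by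
      have hfu : Measurable fun z => f (Function.update x k z) := hfm.comp hup
      have j1 := integrable_mul_log (μ k) hfu hfu ha (fun z => hfab _) (fun z => hfab _)
      have j2 : Integrable (fun z => f (Function.update x k z)) (μ k) :=
        .of_mem_Icc _ _ hfu.aemeasurable (.of_forall fun z => hfab _)
      rw [coordAvg]
      simp only [coordAvg_update, mul_sub]
      rw [integral_sub j1 (j2.mul_const _), integral_mul_const]
      simp only [hf, Real.log_exp]
      rfl
    rw [h2]
    refine h1.trans (le_of_eq ?_)
    simp only [coordAvg, hf, Function.update_self]
  have htens := entropy_le_sum_coordAvg μ hfm ha hfab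
  simp only [hf, Real.log_exp] at htens
  refine htens.trans ((Finset.sum_le_sum fun k _ => by
    simpa only [hf, Real.log_exp] using hk k).trans ?_)
  have iV : ∀ k, Integrable (fun x => f x * (t ^ 2 / 2 * (∫ w, g (τ x) k w ^ 2 ∂μ k)))
      (Measure.pi μ) := fun k => hbdd ((hVτ k).const_mul _) (t ^ 2 / 2) fun x => by
    rw [abs_mul, abs_of_nonneg (hV01 (τ x) k).1, abs_of_nonneg (by positivity)]
    exact mul_le_of_le_one_right (by positivity) (hV01 (τ x) k).2
  have iG : ∀ k, Integrable (fun x => f x * (t ^ 2 * g (τ x) k (x k))) (Measure.pi μ) :=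
    fun k => hbdd ((hgτ k).const_mul _) (t ^ 2) fun x => by
      rw [abs_mul, abs_of_nonneg (sq_nonneg t)]
      exact mul_le_of_le_one_right (by positivity) (hg1 _ _ _)
  have iZ : Integrable (fun x => f x * Z x) (Measure.pi μ) := hbdd hZm N hZN
  have iS : ∀ k, Integrable (fun x => f x * (t ^ 2 / 2 * (∫ w, g (τ x) k w ^ 2 ∂μ k)
      + t ^ 2 * g (τ x) k (x k))) (Measure.pi μ) := fun k => by
    simpa only [mul_add, Pi.add_def] using (iV k).add (iG k)
  rw [← integral_finsetSum _ fun k _ => iS k, ← integral_const_mul, ← integral_const_mul,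
    ← integral_add (ifm.const_mul _) (iZ.const_mul _)]
  refine integral_mono (integrable_finsetSum _ fun k _ => iS k)
    ((ifm.const_mul _).add (iZ.const_mul _)) fun x => ?_
  simp only []
  rw [← Finset.mul_sum, Finset.sum_add_distrib, ← Finset.mul_sum, ← Finset.mul_sum, ← hZ]
  have h1 := mul_le_mul_of_nonneg_left (hV (τ x))
    (mul_nonneg (Real.exp_pos (t * Z x)).le (by positivity : 0 ≤ t ^ 2 / 2))
  simp only [hf]
  linarith

/-- Herbst's argument: `s ↦ (1 / s - 1) * log E exp (s Z) - s V / 2` is antitone on `(0, 1)`, and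
tends to `E Z` at `0`. -/
lemma mgf_le_of_entropy_le {Ω : Type*} [MeasurableSpace Ω] (P : Measure Ω) [IsProbabilityMeasure P]
    {Z : Ω → ℝ} (hZm : Measurable Z) {N V : ℝ} (hZN : ∀ ω, |Z ω| ≤ N)
    (hent : ∀ t : ℝ, 0 < t → t < 1 →
      ∫ ω, Real.exp (t * Z ω) * (t * Z ω) ∂P
        - (∫ ω, Real.exp (t * Z ω) ∂P) * Real.log (∫ ω, Real.exp (t * Z ω) ∂P)
      ≤ t ^ 2 / 2 * V * (∫ ω, Real.exp (t * Z ω) ∂P) + t ^ 2 * ∫ ω, Real.exp (t * Z ω) * Z ω ∂P)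
    {t : ℝ} (ht0 : 0 < t) (ht1 : t < 1) :
    ∫ ω, Real.exp (t * Z ω) ∂P
      ≤ Real.exp ((t * (∫ ω, Z ω ∂P) + t ^ 2 * V / 2) / (1 - t)) := by
  have hset : integrableExpSet Z P = Set.univ := by
    ext s
    simp only [Set.mem_univ, iff_true]
    refine .of_mem_Icc 0 (Real.exp (|s| * N)) (hZm.const_mul s).exp.aemeasurable
      (.of_forall fun ω => ⟨(Real.exp_pos _).le, Real.exp_le_exp.2 ?_⟩)
    exact (le_abs_self _).trans (by
      rw [abs_mul]; exact mul_le_mul_of_nonneg_left (hZN ω) (abs_nonneg s))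
  have hint : ∀ s, s ∈ interior (integrableExpSet Z P) := by simp [hset]
  have hpos : ∀ s, 0 < mgf Z P s := fun s =>
    mgf_pos (interior_subset (hint s) : s ∈ integrableExpSet Z P)
  have hcgf : ∀ s, HasDerivAt (cgf Z P) (P[fun ω => Z ω * Real.exp (s * Z ω)] / mgf Z P s) s :=
    fun s => (hasDerivAt_mgf (hint s)).log (hpos s).ne'
  set G : ℝ → ℝ := fun s => (1 / s - 1) * cgf Z P s - s * V / 2 with hG
  have hGd : ∀ s, 0 < s → HasDerivAt G ((-(1 / s ^ 2)) * cgf Z P s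
      + (1 / s - 1) * (P[fun ω => Z ω * Real.exp (s * Z ω)] / mgf Z P s) - V / 2) s := by
    intro s hs
    have h1 : HasDerivAt (fun s : ℝ => 1 / s - 1) (-(1 / s ^ 2)) s := by
      simpa [one_div] using (hasDerivAt_inv hs.ne').sub_const 1
    have h2 : HasDerivAt (fun s : ℝ => s * V / 2) (V / 2) s := by
      simpa using ((hasDerivAt_id s).mul_const V).div_const 2
    exact (h1.mul (hcgf s)).sub h2
  have hGanti : AntitoneOn G (Set.Ioo 0 1) := by
    refine antitoneOn_of_deriv_nonpos (convex_Ioo 0 1)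
      (fun s hs => (hGd s hs.1).continuousAt.continuousWithinAt)
      (fun s hs => (hGd s (interior_subset hs).1).differentiableAt.differentiableWithinAt)
      fun s hs => ?_
    rw [interior_Ioo] at hs
    rw [(hGd s hs.1).deriv]
    have h := hent s hs.1 hs.2
    have e1 : ∫ ω, Real.exp (s * Z ω) * (s * Z ω) ∂P
        = s * P[fun ω => Z ω * Real.exp (s * Z ω)] := by
      rw [← integral_const_mul]; congr 1; ext ω; ring
    have e2 : ∫ ω, Real.exp (s * Z ω) * Z ω ∂P = P[fun ω => Z ω * Real.exp (s * Z ω)] := by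
      congr 1; ext ω; ring
    rw [e1, e2] at h
    change s * _ - mgf Z P s * cgf Z P s ≤ s ^ 2 / 2 * V * mgf Z P s + _ at h
    set D := P[fun ω => Z ω * Real.exp (s * Z ω)]
    have hM := hpos s
    have hs0 := hs.1
    have : (-(1 / s ^ 2)) * cgf Z P s + (1 / s - 1) * (D / mgf Z P s) - V / 2
        = (s * D - mgf Z P s * cgf Z P s - (s ^ 2 / 2 * V * mgf Z P s + s ^ 2 * D))
          / (s ^ 2 * mgf Z P s) := by
      field_simp
      ring
    rw [this]
    exact div_nonpos_of_nonpos_of_nonneg (by linarith) (by positivity)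
  have hlim : Filter.Tendsto G (nhdsWithin 0 (Set.Ioi 0)) (nhds (∫ ω, Z ω ∂P)) := by
    have h0 : cgf Z P 0 = 0 := cgf_zero
    have hd0 := hcgf 0
    simp only [zero_mul, Real.exp_zero, mul_one, mgf_zero, div_one] at hd0
    have h1 := (hasDerivAt_iff_tendsto_slope.1 hd0).mono_left
      (nhdsWithin_mono 0 (fun s (hs : 0 < s) => hs.ne'))
    have h2 : Filter.Tendsto (fun s => cgf Z P s + s * V / 2) (nhdsWithin 0 (Set.Ioi 0))
        (nhds 0) := by
      have : ContinuousAt (fun s => cgf Z P s + s * V / 2) 0 :=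
        (hcgf 0).continuousAt.add (by fun_prop)
      have := this.tendsto
      simp only [h0, zero_mul, zero_div, add_zero] at this
      exact this.mono_left nhdsWithin_le_nhds
    have h3 := h1.sub h2
    rw [sub_zero] at h3
    refine h3.congr' ?_
    filter_upwards [self_mem_nhdsWithin] with s (hs : 0 < s)
    simp only [hG, slope_def_field, h0, sub_zero]
    field_simp
    ring
  have hle : G t ≤ ∫ ω, Z ω ∂P := by
    refine ge_of_tendsto hlim ?_
    filter_upwards [Ioo_mem_nhdsGT ht0] with s hs
    exact hGanti ⟨hs.1, hs.2.trans ht1⟩ ⟨ht0, ht1⟩ hs.2.le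
  have h1t : 0 < 1 - t := by linarith
  have hfin : cgf Z P t ≤ (t * (∫ ω, Z ω ∂P) + t ^ 2 * V / 2) / (1 - t) := by
    rw [le_div_iff₀ h1t]
    have := mul_le_mul_of_nonneg_left hle ht0.le
    have e : t * G t = cgf Z P t * (1 - t) - t ^ 2 * V / 2 := by
      simp only [hG]; field_simp
    rw [e] at this
    linarith
  calc ∫ ω, Real.exp (t * Z ω) ∂P = Real.exp (cgf Z P t) := (Real.exp_log (hpos t)).symm
    _ ≤ _ := Real.exp_le_exp.2 hfin

/-! ### Suprema of countable families -/

lemma exists_measurable_argmax {Ω T : Type*} [MeasurableSpace Ω] [Finite T] [Nonempty T]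
    [MeasurableSpace T] [MeasurableSingletonClass T] {h : T → Ω → ℝ} (hh : ∀ s, Measurable (h s)) :
    ∃ τ : Ω → T, Measurable τ ∧ ∀ s ω, h s ω ≤ h (τ ω) ω := by
  classical
  have := Fintype.ofFinite T
  obtain ⟨s₀⟩ := ‹Nonempty T›
  have main : ∀ A : Finset T, ∃ τ : Ω → T, Measurable τ ∧ ∀ s ∈ A, ∀ ω, h s ω ≤ h (τ ω) ω := by
    intro A
    induction A using Finset.induction_on with
    | empty => exact ⟨fun _ => s₀, measurable_const, by simp⟩
    | insert a A _ ih =>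
      obtain ⟨τ, hτ, hmax⟩ := ih
      have hhτ : Measurable fun ω => h (τ ω) ω :=
        (measurable_from_prod_countable_right (f := fun p : T × Ω => h p.1 p.2) hh).comp
          (hτ.prodMk measurable_id)
      refine ⟨fun ω => if h (τ ω) ω < h a ω then a else τ ω,
        Measurable.ite (measurableSet_lt hhτ (hh a)) measurable_const hτ, fun s hs ω => ?_⟩
      rcases Finset.mem_insert.1 hs with rfl | hs
      · by_cases hlt : h (τ ω) ω < h s ω
        · simp [hlt]
        · simp only [if_neg hlt]; exact not_lt.1 hlt
      · by_cases hlt : h (τ ω) ω < h a ω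
        · simpa [hlt] using (hmax s hs ω).trans hlt.le
        · simpa [hlt] using hmax s hs ω
  obtain ⟨τ, hτ, hmax⟩ := main Finset.univ
  exact ⟨τ, hτ, fun s ω => hmax s (Finset.mem_univ s) ω⟩

section Supremum

variable {ι : Type*} [Fintype ι] {E : ι → Type*}

lemma abs_sum_comp_apply_le {g : ∀ i, E i → ℝ} {C : ℝ} (hg1 : ∀ i z, |g i z| ≤ C) (x : ∀ i, E i) :
    |∑ i, g i (x i)| ≤ Fintype.card ι * C := by
  refine (Finset.abs_sum_le_sum_abs _ _).trans ?_
  simpa using Finset.sum_le_sum (s := Finset.univ) fun i _ => hg1 i (x i)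

variable [∀ i, MeasurableSpace (E i)]

lemma measurable_sum_comp_apply {g : ∀ i, E i → ℝ} (hg : ∀ i, Measurable (g i)) :
    Measurable fun x : ∀ i, E i => ∑ i, g i (x i) :=
  Finset.measurable_sum _ fun i _ => (hg i).comp (measurable_pi_apply i)

variable (μ : ∀ i, Measure (E i)) [∀ i, IsProbabilityMeasure (μ i)]

lemma integral_exp_iSup_le_of_finite {T : Type*} [Finite T] [Nonempty T]
    (g : T → ∀ i, E i → ℝ) (hg : ∀ s i, Measurable (g s i)) (hg1 : ∀ s i z, |g s i z| ≤ 1)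
    (hg0 : ∀ s i, ∫ z, g s i z ∂μ i = 0) {V : ℝ} (hV : ∀ s, ∑ i, ∫ z, g s i z ^ 2 ∂μ i ≤ V)
    {t : ℝ} (ht0 : 0 < t) (ht1 : t < 1) :
    ∫ x, Real.exp (t * ⨆ s, ∑ i, g s i (x i)) ∂Measure.pi μ
      ≤ Real.exp ((t * (∫ x, ⨆ s, ∑ i, g s i (x i) ∂Measure.pi μ) + t ^ 2 * V / 2) / (1 - t)) := by
  classical
  let mT : MeasurableSpace T := ⊤
  have : MeasurableSingletonClass T := ⟨fun _ => trivial⟩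
  obtain ⟨τ, hτ, hmax⟩ := exists_measurable_argmax fun s => measurable_sum_comp_apply (hg s)
  have hZ : ∀ x : ∀ i, E i, ⨆ s, ∑ i, g s i (x i) = ∑ i, g (τ x) i (x i) := fun x =>
    le_antisymm (ciSup_le fun s => hmax s x)
      (le_ciSup (f := fun s => ∑ i, g s i (x i)) (Set.finite_range _).bddAbove (τ x))
  refine mgf_le_of_entropy_le (Measure.pi μ) (N := Fintype.card ι * 1) (V := V)
    (Measurable.iSup fun s => measurable_sum_comp_apply (hg s))
    (fun x => by rw [hZ]; exact abs_sum_comp_apply_le (hg1 (τ x)) x) (fun s hs0 _ => ?_) ht0 ht1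
  exact entropy_exp_max_pi_le μ g hg hg1 hg0 τ hτ _ hZ
    (fun s x => by rw [hZ]; exact hmax s x) hV hs0.le

lemma integral_exp_iSup_le_of_countable {J : Type*} [Countable J] [Nonempty J]
    (g : J → ∀ i, E i → ℝ) (hg : ∀ s i, Measurable (g s i)) (hg1 : ∀ s i z, |g s i z| ≤ 1)
    (hg0 : ∀ s i, ∫ z, g s i z ∂μ i = 0) {V : ℝ} (hV : ∀ s, ∑ i, ∫ z, g s i z ^ 2 ∂μ i ≤ V)
    {t : ℝ} (ht0 : 0 < t) (ht1 : t < 1) :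
    ∫ x, Real.exp (t * ⨆ s, ∑ i, g s i (x i)) ∂Measure.pi μ
      ≤ Real.exp ((t * (∫ x, ⨆ s, ∑ i, g s i (x i) ∂Measure.pi μ) + t ^ 2 * V / 2) / (1 - t)) := by
  obtain ⟨e, he⟩ := exists_surjective_nat J
  set N : ℝ := Fintype.card ι * 1
  set Y : J → (∀ i, E i) → ℝ := fun s x => ∑ i, g s i (x i) with hY
  have hYN : ∀ s x, |Y s x| ≤ N := fun s x => abs_sum_comp_apply_le (hg1 s) x
  have hYm : ∀ s, Measurable (Y s) := fun s => measurable_sum_comp_apply (hg s)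
  have hbdd : ∀ x, BddAbove (Set.range fun s => Y s x) := fun x =>
    ⟨N, by rintro _ ⟨s, rfl⟩; exact (abs_le.1 (hYN s x)).2⟩
  set Z : (∀ i, E i) → ℝ := fun x => ⨆ s, Y s x with hZ
  -- the suprema over the first elements of the family, which increase to `Z`
  set W : ℕ → (∀ i, E i) → ℝ := fun n x => ⨆ k : Fin (n + 1), Y (e k) x with hW
  have hWbdd : ∀ n x, BddAbove (Set.range fun k : Fin (n + 1) => Y (e k) x) := fun n x =>
    (Set.finite_range _).bddAbove
  have hZm : Measurable Z := Measurable.iSup hYm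
  have hWm : ∀ n, Measurable (W n) := fun n => Measurable.iSup fun k => hYm _
  have hWZ : ∀ n x, W n x ≤ Z x := fun n x => ciSup_le fun k => le_ciSup (hbdd x) (e k)
  have hWge : ∀ n x, -N ≤ W n x := fun n x =>
    (abs_le.1 (hYN (e 0) x)).1.trans (le_ciSup (hWbdd n x) 0)
  have hZle : ∀ x, Z x ≤ N := fun x => ciSup_le fun s => (abs_le.1 (hYN s x)).2
  have hlim : ∀ x, Filter.Tendsto (fun n => W n x) Filter.atTop (nhds (Z x)) := by
    intro x
    rw [tendsto_order]
    refine ⟨fun a ha => ?_, fun a ha => .of_forall fun n => (hWZ n x).trans_lt ha⟩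
    obtain ⟨s, hs⟩ := exists_lt_of_lt_ciSup ha
    obtain ⟨n, rfl⟩ := he s
    filter_upwards [Filter.eventually_ge_atTop n] with m hm
    exact hs.trans_le (le_ciSup (hWbdd m x) ⟨n, Nat.lt_succ_of_le hm⟩)
  have iW : ∀ n, Integrable (W n) (Measure.pi μ) := fun n =>
    .of_mem_Icc (-N) N (hWm n).aemeasurable
      (.of_forall fun x => ⟨hWge n x, (hWZ n x).trans (hZle x)⟩)
  have iZ : Integrable Z (Measure.pi μ) :=
    .of_mem_Icc (-N) N hZm.aemeasurable
      (.of_forall fun x => ⟨(hWge 0 x).trans (hWZ 0 x), hZle x⟩)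
  have hconv : Filter.Tendsto (fun n => ∫ x, Real.exp (t * W n x) ∂Measure.pi μ) Filter.atTop
      (nhds (∫ x, Real.exp (t * Z x) ∂Measure.pi μ)) := by
    refine tendsto_integral_of_dominated_convergence (fun _ => Real.exp (t * N))
      (fun n => ((hWm n).const_mul t).exp.aestronglyMeasurable) (integrable_const _)
      (fun n => .of_forall fun x => ?_) (.of_forall fun x => ?_)
    · rw [Real.norm_eq_abs, Real.abs_exp]
      exact Real.exp_le_exp.2 (mul_le_mul_of_nonneg_left ((hWZ n x).trans (hZle x)) ht0.le)
    · exact (Real.continuous_exp.tendsto _).comp ((hlim x).const_mul t)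
  refine le_of_tendsto hconv (.of_forall fun n => ?_)
  refine (integral_exp_iSup_le_of_finite μ (fun k : Fin (n + 1) => g (e k)) (fun k => hg _)
    (fun k => hg1 _) (fun k => hg0 _) (fun k => hV _) ht0 ht1).trans ?_
  have h1t : 0 < 1 - t := by linarith
  refine Real.exp_le_exp.2 (div_le_div_of_nonneg_right ?_ h1t.le)
  have := mul_le_mul_of_nonneg_left (integral_mono (iW n) iZ (hWZ n)) ht0.le
  simp only [hW, hZ, hY] at this ⊢
  linarith

/-- Upper bound on the moment generating function of the supremum `Z` of the absolute values of a
countable family of sums of independent centred variables bounded by `1`. As a function of `t`, the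
exponent is `t E Z + t² (V + 2 E Z) / (2 (1 - t))`. -/
theorem integral_exp_iSup_abs_le {J : Type*} [Countable J] [Nonempty J]
    (g : J → ∀ i, E i → ℝ) (hg : ∀ s i, Measurable (g s i)) (hg1 : ∀ s i z, |g s i z| ≤ 1)
    (hg0 : ∀ s i, ∫ z, g s i z ∂μ i = 0) {V : ℝ} (hV : ∀ s, ∑ i, ∫ z, g s i z ^ 2 ∂μ i ≤ V)
    {t : ℝ} (ht0 : 0 < t) (ht1 : t < 1) :
    ∫ x, Real.exp (t * ⨆ s, |∑ i, g s i (x i)|) ∂Measure.pi μ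
      ≤ Real.exp ((t * (∫ x, ⨆ s, |∑ i, g s i (x i)| ∂Measure.pi μ) + t ^ 2 * V / 2)
        / (1 - t)) := by
  -- adjoin the opposite of each member of the family
  have hsup : ∀ x : ∀ i, E i, ⨆ s, |∑ i, g s i (x i)|
      = ⨆ p : J × Bool, ∑ i, (if p.2 then (1 : ℝ) else -1) * g p.1 i (x i) := by
    intro x
    have hb1 : BddAbove (Set.range fun s => |∑ i, g s i (x i)|) :=
      ⟨_, by rintro _ ⟨s, rfl⟩; exact abs_sum_comp_apply_le (hg1 s) x⟩
    have hle : ∀ p : J × Bool, ∑ i, (if p.2 then (1 : ℝ) else -1) * g p.1 i (x i)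
        ≤ |∑ i, g p.1 i (x i)| := by
      rintro ⟨s, b⟩
      rw [← Finset.mul_sum]
      cases b
      · simpa using neg_le_abs (∑ i, g s i (x i))
      · simpa using le_abs_self (∑ i, g s i (x i))
    have hb2 : BddAbove (Set.range fun p : J × Bool =>
        ∑ i, (if p.2 then (1 : ℝ) else -1) * g p.1 i (x i)) :=
      ⟨_, by rintro _ ⟨p, rfl⟩; exact (hle p).trans (abs_sum_comp_apply_le (hg1 p.1) x)⟩
    refine le_antisymm (ciSup_le fun s => ?_) (ciSup_le fun p => (hle p).trans (le_ciSup hb1 p.1))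
    refine abs_le'.2 ⟨?_, ?_⟩
    · simpa using le_ciSup hb2 (s, true)
    · simpa using le_ciSup hb2 (s, false)
  simp only [hsup]
  have hsign : ∀ b : Bool, (if b then (1 : ℝ) else -1) ^ 2 = 1 := by simp
  refine integral_exp_iSup_le_of_countable μ
    (fun (p : J × Bool) i z => (if p.2 then (1 : ℝ) else -1) * g p.1 i z)
    (fun p i => (hg p.1 i).const_mul _) (fun p i z => ?_) (fun p i => ?_) (fun p => ?_) ht0 ht1
  · rw [abs_mul]
    rcases p with ⟨s, b⟩
    cases b <;> simpa using hg1 s i z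
  · rw [integral_const_mul, hg0, mul_zero]
  · simpa only [mul_pow, hsign, one_mul] using hV p.1

end Supremum

/-! ### From the moment generating function to the tail -/

lemma one_sub_exp_neg_le_measureReal_le {Ω : Type*} [MeasurableSpace Ω] (P : Measure Ω)
    [IsProbabilityMeasure P] {W : Ω → ℝ} {e V x α : ℝ} (he : 0 ≤ e) (hV : 0 ≤ V) (hx : 0 ≤ x)
    (hα : 0 < α) (hint : ∀ t, Integrable (fun ω => Real.exp (t * W ω)) P)
    (hmgf : ∀ t, 0 < t → t < 1 →
      ∫ ω, Real.exp (t * W ω) ∂P ≤ Real.exp ((t * e + t ^ 2 * V / 2) / (1 - t))) :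
    1 - Real.exp (-x)
      ≤ P.real {ω | W ω ≤ (1 + α) * e + Real.sqrt (2 * V * x) + (3 / 2 + 1 / α) * x} := by
  rcases hx.eq_or_lt with rfl | hx0
  · simp
  set q := (1 + α) * e + Real.sqrt (2 * V * x) + (3 / 2 + 1 / α) * x with hq
  -- the variance proxy that the moment generating function exhibits
  set v := V + 2 * e with hv
  have hqv : e + Real.sqrt (2 * v * x) + 3 / 2 * x ≤ q := by
    have h1 : 0 ≤ α * e + 1 / α * x := by positivity
    have h2 : Real.sqrt (2 * v * x) ≤ Real.sqrt (2 * V * x) + (α * e + 1 / α * x) := by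
      refine Real.sqrt_le_iff.2 ⟨by positivity, ?_⟩
      have h3 := Real.sq_sqrt (show 0 ≤ 2 * V * x by positivity)
      have h4 : 4 * (e * x) ≤ (α * e + 1 / α * x) ^ 2 := by
        have h5 : (α * e + 1 / α * x) ^ 2 = (α * e - 1 / α * x) ^ 2 + 4 * (e * x) := by
          field_simp; ring
        nlinarith [sq_nonneg (α * e - 1 / α * x)]
      have h6 := mul_nonneg (Real.sqrt_nonneg (2 * V * x)) h1
      rw [hv]
      nlinarith
    rw [hq]
    linarith
  have hopt : ∃ t, 0 < t ∧ t < 1 ∧ x ≤ t * q - (t * e + t ^ 2 * V / 2) / (1 - t) := by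
    rcases (show 0 ≤ v by positivity).eq_or_lt with hv0 | hv0
    · have e0 : e = 0 := by linarith
      have V0 : V = 0 := by linarith
      refine ⟨2 / 3, by norm_num, by norm_num, ?_⟩
      simp only [e0, V0, ← hv0] at hqv ⊢
      norm_num at hqv ⊢
      linarith
    · -- `t / (1 - t) = r` minimizes the exponent
      set r := Real.sqrt (2 * v * x) / v with hr
      have hr0 : 0 < r := by positivity
      have hrv : Real.sqrt (2 * v * x) = r * v := by rw [hr]; field_simp
      have hxr : x = r ^ 2 * v / 2 := by
        rw [hr, div_pow, Real.sq_sqrt (by positivity)]; field_simp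
      refine ⟨r / (1 + r), by positivity, by rw [div_lt_one (by positivity)]; linarith, ?_⟩
      have h1 : 1 - r / (1 + r) = 1 / (1 + r) := by field_simp; ring
      have h2 : r / (1 + r) * (e + r * v + x) - (r / (1 + r) * e + (r / (1 + r)) ^ 2 * V / 2)
          / (1 - r / (1 + r)) = x := by
        rw [h1, hxr, hv]; field_simp; ring
      have h3 := mul_le_mul_of_nonneg_left (show e + r * v + x ≤ q by linarith)
        (show 0 ≤ r / (1 + r) by positivity)
      linarith
  obtain ⟨t, ht0, ht1, ht⟩ := hopt
  have htail : P.real {ω | q ≤ W ω} ≤ Real.exp (-x) := by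
    refine (measure_ge_le_exp_mul_mgf q ht0.le (hint t)).trans ?_
    refine (mul_le_mul_of_nonneg_left (hmgf t ht0 ht1) (Real.exp_pos _).le).trans ?_
    rw [← Real.exp_add]
    exact Real.exp_le_exp.2 (by linarith)
  have hcover : (1 : ℝ) ≤ P.real {ω | W ω ≤ q} + P.real {ω | q ≤ W ω} := by
    have : {ω | W ω ≤ q} ∪ {ω | q ≤ W ω} = Set.univ :=
      Set.eq_univ_of_forall fun ω => le_total (W ω) q
    rw [← probReal_univ (μ := P), ← this]
    exact measureReal_union_le _ _
  linarith

/-! ### Averaging over permutations and pairing of i.i.d. variables -/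

/-- Averaging a function of two distinct indices over all permutations is averaging it over all
pairs of distinct indices. -/
lemma card_offDiag_mul_sum_perm {A : Type*} [Fintype A] [DecidableEq A] (g : A → A → ℝ) {a b : A}
    (hab : a ≠ b) :
    ((Finset.univ : Finset A).offDiag.card : ℝ) * ∑ π : Equiv.Perm A, g (π a) (π b)
      = (Fintype.card (Equiv.Perm A) : ℝ) *
        ∑ p ∈ (Finset.univ : Finset A).offDiag, g p.1 p.2 := by
  have h1 : ∀ p ∈ (Finset.univ : Finset A).offDiag,
      ∑ π : Equiv.Perm A, g (π p.1) (π p.2) = ∑ π : Equiv.Perm A, g (π a) (π b) := by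
    intro p hp
    obtain ⟨ρ, h1, h2⟩ := MulAction.is_two_pretransitive_iff.1
      (Equiv.Perm.isMultiplyPretransitive A 2) hab (Finset.mem_offDiag.1 hp).2.2
    simp only [Equiv.Perm.smul_def] at h1 h2
    exact Fintype.sum_equiv (Equiv.mulRight ρ) _ _ fun π => by simp [h1, h2]
  have h2 : ∀ π : Equiv.Perm A, ∑ p ∈ (Finset.univ : Finset A).offDiag, g (π p.1) (π p.2)
      = ∑ p ∈ (Finset.univ : Finset A).offDiag, g p.1 p.2 := by
    intro π
    refine Finset.sum_bij' (fun p _ => (π p.1, π p.2)) (fun p _ => (π.symm p.1, π.symm p.2))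
      ?_ ?_ ?_ ?_ ?_ <;> simp
  rw [← nsmul_eq_mul, ← Finset.sum_const, ← Finset.sum_congr rfl h1, Finset.sum_comm,
    Finset.sum_congr rfl fun π _ => h2 π]
  simp

/-- Pairing up i.i.d. variables along two injections with disjoint ranges gives i.i.d. pairs. -/
lemma map_pair_eq_pi_prod {Ω S ι κ : Type*} [MeasurableSpace Ω] [MeasurableSpace S] [Fintype ι]
    (P : Measure Ω) [IsProbabilityMeasure P] (μ : Measure S) [IsProbabilityMeasure μ]
    {X : κ → Ω → S} (hXm : ∀ k, Measurable (X k)) (hX : iIndepFun X P)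
    (hμ : ∀ k, P.map (X k) = μ) {φ : ι ⊕ ι → κ} (hφ : Function.Injective φ) :
    P.map (fun ω i => (X (φ (.inl i)) ω, X (φ (.inr i)) ω))
      = Measure.pi fun _ : ι => μ.prod μ := by
  have h1 : MeasurePreserving (fun ω (k : ι ⊕ ι) => X (φ k) ω) P (Measure.pi fun _ => μ) := by
    refine ⟨measurable_pi_lambda _ fun k => hXm _, ?_⟩
    rw [(iIndepFun_iff_map_fun_eq_pi_map fun k => (hXm _).aemeasurable).1 (hX.precomp hφ)]
    simp only [hμ]
  have h2 := measurePreserving_sumPiEquivProdPi (fun _ : ι ⊕ ι => μ)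
  have h3 := (measurePreserving_arrowProdEquivProdArrow S S ι (fun _ => μ) (fun _ => μ)).symm
  exact ((h3.comp h2).comp h1).map_eq

/-! ### Decoupling of the U-statistic into sums over disjoint pairs -/

section Pairs

variable {Ω S : Type*} {n m : ℕ}

/-- The pairs `(X_{i π(j)}, X_{i π(⌊m/2⌋ + j)})`, indexed by `(i, j)`. -/
def permPair (X : Fin n → Fin m → Ω → S) (π : Equiv.Perm (Fin m)) (ω : Ω) :
    Fin n × Fin (m / 2) → S × S :=
  fun p => (X p.1 (π (firstHalf p.2)) ω, X p.1 (π (secondHalf p.2)) ω)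

/-- The supremum over the class of the absolute values of the sums over the pairs, with the
functions divided by their bound `U`. It is a function of the pairs, so that its expectations are
integrals against their law. -/
noncomputable def pairSup (F : Set (S × S → Fin n → ℝ)) (U : ℝ)
    (y : Fin n × Fin (m / 2) → S × S) : ℝ :=
  ⨆ f : F, |∑ p, f.1 (y p) p.1 / U|

lemma abs_div_le_one {F : Set (S × S → Fin n → ℝ)} {U : ℝ} (hU0 : 0 < U)
    (hU : ∀ f ∈ F, ∀ i, ∀ z : S × S, |f z i| ≤ U) (f : F) (i : Fin n) (z : S × S) :
    |f.1 z i / U| ≤ 1 := by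
  rw [abs_div, abs_of_pos hU0, div_le_one hU0]
  exact hU f.1 f.2 i z

lemma abs_sum_div_le {F : Set (S × S → Fin n → ℝ)} {U : ℝ} (hU0 : 0 < U)
    (hU : ∀ f ∈ F, ∀ i, ∀ z : S × S, |f z i| ≤ U) (f : F) (y : Fin n × Fin (m / 2) → S × S) :
    |∑ p, f.1 (y p) p.1 / U| ≤ Fintype.card (Fin n × Fin (m / 2)) * 1 :=
  abs_sum_comp_apply_le (g := fun (p : Fin n × Fin (m / 2)) (z : S × S) => f.1 z p.1 / U)
    (fun p z => abs_div_le_one hU0 hU f p.1 z) y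

lemma le_pairSup {F : Set (S × S → Fin n → ℝ)} {U : ℝ} (hU0 : 0 < U)
    (hU : ∀ f ∈ F, ∀ i, ∀ z : S × S, |f z i| ≤ U) (f : F) (y : Fin n × Fin (m / 2) → S × S) :
    |∑ p, f.1 (y p) p.1 / U| ≤ pairSup F U y :=
  le_ciSup (f := fun f : F => |∑ p, f.1 (y p) p.1 / U|)
    ⟨_, by rintro _ ⟨f, rfl⟩; exact abs_sum_div_le hU0 hU f y⟩ f

lemma splitSup_eq (F : Set (S × S → Fin n → ℝ)) {U : ℝ} (hU0 : 0 < U)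
    (X : Fin n → Fin m → Ω → S) (ω : Ω) :
    splitSup F X ω = U * pairSup F U (permPair X 1 ω) := by
  unfold splitSup pairSup permPair
  rw [Real.mul_iSup_of_nonneg hU0.le]
  congr 1
  ext f
  rw [← Finset.sum_div, abs_div, abs_of_pos hU0, mul_div_cancel₀ _ hU0.ne',
    Fintype.sum_prod_type]
  rfl

/-- Hoeffding's decomposition: the U-statistic is dominated by the average, over the permutations
of the second index, of the sums over disjoint pairs. -/
lemma uStatSup_le {F : Set (S × S → Fin n → ℝ)} (hF : F.Nonempty) {U : ℝ}
    (hU0 : 0 < U) (hU : ∀ f ∈ F, ∀ i, ∀ z : S × S, |f z i| ≤ U)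
    (X : Fin n → Fin m → Ω → S) (ω : Ω) :
    ((m / 2 : ℕ) : ℝ) * uStatSup F X ω ≤ (m : ℝ) * ((m : ℝ) - 1) * U *
      ((Fintype.card (Equiv.Perm (Fin m)) : ℝ)⁻¹ * ∑ π, pairSup F U (permPair X π ω)) := by
  have hne : Nonempty F := hF.to_subtype
  have hh : (0 : ℝ) ≤ ((m / 2 : ℕ) : ℝ) := Nat.cast_nonneg _
  have hcard : (((Finset.univ : Finset (Fin m)).offDiag.card : ℕ) : ℝ)
      = (m : ℝ) * ((m : ℝ) - 1) := by
    rw [Finset.offDiag_card, Finset.card_univ, Fintype.card_fin,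
      Nat.cast_sub (Nat.le_mul_self m)]
    push_cast
    ring
  have hd : (0 : ℝ) ≤ (m : ℝ) * ((m : ℝ) - 1) := by rw [← hcard]; exact Nat.cast_nonneg _
  have hM : (0 : ℝ) < (Fintype.card (Equiv.Perm (Fin m)) : ℝ) := by
    exact_mod_cast Fintype.card_pos
  unfold uStatSup
  rw [Real.mul_iSup_of_nonneg hh]
  refine ciSup_le fun f => ?_
  have hsum : (m : ℝ) * ((m : ℝ) - 1) * ∑ π : Equiv.Perm (Fin m),
      ∑ p : Fin n × Fin (m / 2), f.1 (permPair X π ω p) p.1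
      = (Fintype.card (Equiv.Perm (Fin m)) : ℝ) * (((m / 2 : ℕ) : ℝ) *
        ∑ i : Fin n, ∑ p ∈ (Finset.univ : Finset (Fin m)).offDiag,
          f.1 (X i p.1 ω, X i p.2 ω) i) := by
    have hp : ∀ p : Fin n × Fin (m / 2), (m : ℝ) * ((m : ℝ) - 1) *
        ∑ π : Equiv.Perm (Fin m), f.1 (permPair X π ω p) p.1
        = (Fintype.card (Equiv.Perm (Fin m)) : ℝ) *
          ∑ q ∈ (Finset.univ : Finset (Fin m)).offDiag, f.1 (X p.1 q.1 ω, X p.1 q.2 ω) p.1 := by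
      intro p
      rw [← hcard]
      refine card_offDiag_mul_sum_perm (fun a b => f.1 (X p.1 a ω, X p.1 b ω) p.1) fun h => ?_
      have h1 := congrArg Fin.val h
      have h2 := p.2.2
      simp only [firstHalf, secondHalf] at h1
      omega
    rw [Finset.sum_comm, Finset.mul_sum, Finset.sum_congr rfl fun p _ => hp p, ← Finset.mul_sum,
      Fintype.sum_prod_type]
    simp [Finset.mul_sum]
  set T := ∑ i : Fin n, ∑ p ∈ (Finset.univ : Finset (Fin m)).offDiag,
    f.1 (X i p.1 ω, X i p.2 ω) i
  have hT : ((m / 2 : ℕ) : ℝ) * T = (m : ℝ) * ((m : ℝ) - 1) * U *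
      ((Fintype.card (Equiv.Perm (Fin m)) : ℝ)⁻¹ * ∑ π : Equiv.Perm (Fin m),
      ∑ p : Fin n × Fin (m / 2), f.1 (permPair X π ω p) p.1 / U) := by
    simp only [← Finset.sum_div]
    field_simp
    linarith
  have habs : ((m / 2 : ℕ) : ℝ) * |T| = |((m / 2 : ℕ) : ℝ) * T| := by
    rw [abs_mul, abs_of_nonneg hh]
  rw [habs, hT, abs_mul, abs_of_nonneg (mul_nonneg hd hU0.le), abs_mul,
    abs_of_nonneg (inv_nonneg.2 hM.le)]
  refine mul_le_mul_of_nonneg_left (mul_le_mul_of_nonneg_left ?_ (inv_nonneg.2 hM.le))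
    (mul_nonneg hd hU0.le)
  exact (Finset.abs_sum_le_sum_abs _ _).trans
    (Finset.sum_le_sum fun π _ => le_pairSup hU0 hU f _)

variable [MeasurableSpace Ω] [MeasurableSpace S]

lemma measurable_permPair {X : Fin n → Fin m → Ω → S} (hX : ∀ i j, Measurable (X i j))
    (π : Equiv.Perm (Fin m)) : Measurable (permPair X π) :=
  measurable_pi_lambda _ fun _ => (hX _ _).prodMk (hX _ _)

lemma measurable_pairSup {F : Set (S × S → Fin n → ℝ)} (hF : F.Countable)
    (hF_meas : ∀ f ∈ F, Measurable f) (U : ℝ) :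
    Measurable (pairSup (m := m) F U) := by
  have : Countable F := hF.to_subtype
  refine Measurable.iSup fun f => Measurable.abs ?_
  exact measurable_sum_comp_apply (g := fun (p : Fin n × Fin (m / 2)) (z : S × S) =>
    f.1 z p.1 / U) fun p => ((measurable_pi_apply p.1).comp (hF_meas f.1 f.2)).div_const U

lemma map_permPair (P : Measure Ω) [IsProbabilityMeasure P] (μ : Measure S)
    [IsProbabilityMeasure μ] {X : Fin n → Fin m → Ω → S} (hX_meas : ∀ i j, Measurable (X i j))
    (hX_indep : iIndepFun (fun p : Fin n × Fin m => X p.1 p.2) P)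
    (hμ : ∀ i j, P.map (X i j) = μ) (π : Equiv.Perm (Fin m)) :
    P.map (permPair X π) = Measure.pi fun _ => μ.prod μ := by
  refine map_pair_eq_pi_prod (ι := Fin n × Fin (m / 2)) P μ
    (X := fun p : Fin n × Fin m => X p.1 p.2) (fun p => hX_meas _ _) hX_indep (fun p => hμ _ _)
    (φ := Sum.elim (fun p => (p.1, π (firstHalf p.2))) (fun p => (p.1, π (secondHalf p.2)))) ?_
  rintro (⟨i, j⟩ | ⟨i, j⟩) (⟨i', j'⟩ | ⟨i', j'⟩) h <;>
    simp only [Sum.elim_inl, Sum.elim_inr, Prod.mk.injEq, EmbeddingLike.apply_eq_iff_eq, firstHalf,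
      secondHalf, Fin.mk.injEq] at h
  · simp [h.1, Fin.ext h.2]
  · have := j.2; omega
  · have := j'.2; omega
  · have : j = j' := Fin.ext (by omega)
    simp [h.1, this]

end Pairs

/-- Jensen's inequality for the exponential of an average of variables whose exponentials have the
same mean bound. -/
lemma integral_exp_average_le {Ω A : Type*} [MeasurableSpace Ω] (P : Measure Ω) [Fintype A]
    [Nonempty A] {Y : A → Ω → ℝ} {t K : ℝ} (hi : ∀ a, Integrable (fun ω => Real.exp (t * Y a ω)) P)
    (hi' : Integrable (fun ω => Real.exp (t * ((Fintype.card A : ℝ)⁻¹ * ∑ a, Y a ω))) P)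
    (hK : ∀ a, ∫ ω, Real.exp (t * Y a ω) ∂P ≤ K) :
    ∫ ω, Real.exp (t * ((Fintype.card A : ℝ)⁻¹ * ∑ a, Y a ω)) ∂P ≤ K := by
  have hA : (0 : ℝ) < (Fintype.card A : ℝ) := by exact_mod_cast Fintype.card_pos
  have h : ∫ ω, Real.exp (t * ((Fintype.card A : ℝ)⁻¹ * ∑ a, Y a ω)) ∂P
      ≤ ∫ ω, ∑ a, (Fintype.card A : ℝ)⁻¹ * Real.exp (t * Y a ω) ∂P := by
    refine integral_mono hi' (integrable_finsetSum _ fun a _ => (hi a).const_mul _) fun ω => ?_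
    have := convexOn_exp.map_sum_le (t := (Finset.univ : Finset A))
      (w := fun _ => (Fintype.card A : ℝ)⁻¹) (p := fun a => t * Y a ω)
      (fun _ _ => inv_nonneg.2 hA.le) (by simp [hA.ne']) (fun _ _ => Set.mem_univ _)
    simp only [smul_eq_mul] at this
    refine le_of_eq_of_le ?_ this
    congr 1
    rw [Finset.mul_sum, Finset.mul_sum]
    exact Finset.sum_congr rfl fun a _ => by ring
  refine h.trans ?_
  rw [integral_finsetSum _ fun a _ => (hi a).const_mul _]
  simp only [integral_const_mul]
  rw [← Finset.mul_sum, inv_mul_le_iff₀ hA]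
  simpa using Finset.sum_le_sum (s := Finset.univ) fun a _ => hK a

theorem mainTheorem2 {Ω S : Type*} [MeasurableSpace Ω] [MeasurableSpace S]
    (P : Measure Ω) [IsProbabilityMeasure P]
    (n m : ℕ) (hn : 1 ≤ n) (hm : 2 ≤ m)
    (X : Fin n → Fin m → Ω → S)
    (hX_meas : ∀ i j, Measurable (X i j))
    (hX_indep : iIndepFun (fun p : Fin n × Fin m => X p.1 p.2) P)
    (hX_ident : ∀ i j i' j', IdentDistrib (X i j) (X i' j') P P)
    (F : Set (S × S → Fin n → ℝ)) (hF_nonempty : F.Nonempty) (hF_countable : F.Countable)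
    (hF_meas : ∀ f ∈ F, Measurable f)
    (U : ℝ) (hU : ∀ f ∈ F, ∀ i, ∀ z : S × S, |f z i| ≤ U)
    (hF_centered : ∀ f ∈ F, ∀ i,
      ∫ ω, f (X i ⟨0, by omega⟩ ω, X i ⟨1, by omega⟩ ω) i ∂P = 0)
    (σ : ℝ) (hσU : σ ^ 2 ≤ U ^ 2)
    (hσ : ∀ f ∈ F,
      1 / (n : ℝ) * (1 / ((m / 2 : ℕ) : ℝ)) *
        ∑ i : Fin n, ∑ j : Fin (m / 2),
          ∫ ω, (f (X i (firstHalf j) ω, X i (secondHalf j) ω) i) ^ 2 ∂P ≤ σ ^ 2)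
    (x : ℝ) (hx : 0 ≤ x) (α : ℝ) (hα : 0 < α) :
    1 - Real.exp (-x) ≤
      P.real {ω | 1 / ((n : ℝ) * (m : ℝ) * ((m : ℝ) - 1)) * uStatSup F X ω ≤
        (1 + α) * ∫ ω', splitSup F X ω' / ((n : ℝ) * ((m / 2 : ℕ) : ℝ)) ∂P
          + Real.sqrt (2 * σ ^ 2 / ((n : ℝ) * ((m / 2 : ℕ) : ℝ)) * x)
          + (3 / 2 + 1 / α) * (U * x / ((n : ℝ) * ((m / 2 : ℕ) : ℝ)))} := by
  have hne : Nonempty F := hF_nonempty.to_subtype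
  have hcount : Countable F := hF_countable.to_subtype
  obtain ⟨ω₀⟩ : Nonempty Ω := P.nonempty_of_neZero
  obtain ⟨f₀, hf₀⟩ := hF_nonempty
  let i₀ : Fin n := ⟨0, hn⟩
  let j₀ : Fin m := ⟨0, by omega⟩
  have hUnn : 0 ≤ U := (abs_nonneg _).trans (hU f₀ hf₀ i₀ (X i₀ j₀ ω₀, X i₀ j₀ ω₀))
  rcases hUnn.eq_or_lt with rfl | hU0
  · -- for `U = 0` every function of the class vanishes
    have hz : ∀ (f : F) z i, f.1 z i = 0 := fun f z i =>
      abs_eq_zero.1 (le_antisymm (hU f.1 f.2 i z) (abs_nonneg _))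
    have h1 : ∀ ω, uStatSup F X ω = 0 := fun ω => by simp [uStatSup, hz]
    have h2 : ∀ ω, splitSup F X ω = 0 := fun ω => by simp [splitSup, hz]
    simp only [h1, h2]
    have h3 := Real.sqrt_nonneg (2 * σ ^ 2 / ((n : ℝ) * ((m / 2 : ℕ) : ℝ)) * x)
    simp [h3, (Real.exp_pos (-x)).le]
  set h : ℕ := m / 2 with hh
  have hhpos : (0 : ℝ) < (h : ℝ) := by exact_mod_cast (by omega : 0 < m / 2)
  have hnpos : (0 : ℝ) < (n : ℝ) := by exact_mod_cast hn
  have hm1 : (1 : ℝ) < (m : ℝ) := by exact_mod_cast (by omega : 1 < m)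
  -- the common law of the variables
  set μ : Measure S := P.map (X i₀ j₀) with hμ
  have : IsProbabilityMeasure μ := Measure.isProbabilityMeasure_map (hX_meas i₀ j₀).aemeasurable
  have hlaw : ∀ i j, P.map (X i j) = μ := fun i j => (hX_ident i j i₀ j₀).map_eq
  have hpair : ∀ i {j k : Fin m}, j ≠ k → P.map (fun ω => (X i j ω, X i k ω)) = μ.prod μ := by
    intro i j k hjk
    have hind : IndepFun (X i j) (X i k) P :=
      hX_indep.indepFun (i := (i, j)) (j := (i, k)) (by simpa using hjk)
    rw [(indepFun_iff_map_prod_eq_prod_map_map (hX_meas i j).aemeasurable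
      (hX_meas i k).aemeasurable).1 hind, hlaw, hlaw]
  have hintpair : ∀ i {j k : Fin m}, j ≠ k → ∀ {φ : S × S → ℝ}, Measurable φ →
      ∫ ω, φ (X i j ω, X i k ω) ∂P = ∫ z, φ z ∂μ.prod μ := by
    intro i j k hjk φ hφ
    rw [← hpair i hjk, integral_map ((hX_meas i j).prodMk (hX_meas i k)).aemeasurable
      hφ.aestronglyMeasurable]
  have hfm : ∀ (f : F) i, Measurable fun z => f.1 z i := fun f i =>
    (measurable_pi_apply i).comp (hF_meas f.1 f.2)
  let ν : Fin n × Fin h → Measure (S × S) := fun _ => μ.prod μ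
  set Φ : (Fin n × Fin h → S × S) → ℝ := pairSup F U with hΦ
  have hΦm : Measurable Φ := measurable_pairSup hF_countable hF_meas U
  have hΦ0 : ∀ y, 0 ≤ Φ y := fun y => Real.iSup_nonneg fun f => abs_nonneg _
  have hΦle : ∀ y, Φ y ≤ Fintype.card (Fin n × Fin h) * 1 := fun y =>
    ciSup_le fun f => abs_sum_div_le hU0 hU f y
  set e := ∫ y, Φ y ∂Measure.pi ν with he
  have he0 : 0 ≤ e := integral_nonneg hΦ0
  set V := (n : ℝ) * h * σ ^ 2 / U ^ 2 with hV
  have hmgfΦ : ∀ t, 0 < t → t < 1 → ∫ y, Real.exp (t * Φ y) ∂Measure.pi ν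
      ≤ Real.exp ((t * e + t ^ 2 * V / 2) / (1 - t)) := by
    intro t ht0 ht1
    refine integral_exp_iSup_abs_le ν (fun (f : F) p z => f.1 z p.1 / U)
      (fun f p => (hfm f p.1).div_const U) (fun f p z => abs_div_le_one hU0 hU f p.1 z)
      (fun f p => ?_) (fun f => ?_) ht0 ht1
    · rw [integral_div, ← hintpair p.1 (j := ⟨0, by omega⟩) (k := ⟨1, by omega⟩) (by simp)
        (hfm f p.1), hF_centered f.1 f.2 p.1, zero_div]
    · have h1 : ∀ p : Fin n × Fin h, ∫ z, (f.1 z p.1 / U) ^ 2 ∂ν p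
          = (∫ ω, (f.1 (X p.1 (firstHalf p.2) ω, X p.1 (secondHalf p.2) ω) p.1) ^ 2 ∂P)
            / U ^ 2 := by
        intro p
        simp only [div_pow]
        rw [integral_div, hintpair p.1 (fun hc => ?_) ((hfm f p.1).pow_const 2)]
        have h2 := congrArg Fin.val hc
        have h3 := p.2.2
        simp only [firstHalf, secondHalf] at h2
        omega
      rw [Finset.sum_congr rfl fun p _ => h1 p, ← Finset.sum_div, Fintype.sum_prod_type, hV]
      have h2 := hσ f.1 f.2
      refine div_le_div_of_nonneg_right ?_ (by positivity)
      rw [one_div_mul_one_div, one_div, inv_mul_le_iff₀ (by positivity)] at h2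
      exact h2
  set W : Ω → ℝ := fun ω => (Fintype.card (Equiv.Perm (Fin m)) : ℝ)⁻¹ *
    ∑ π, Φ (permPair X π ω) with hW
  have hYm : ∀ π, Measurable fun ω => Φ (permPair X π ω) := fun π =>
    hΦm.comp (measurable_permPair hX_meas π)
  have hWm : Measurable W := (Finset.measurable_sum _ fun π _ => hYm π).const_mul _
  have hM : (0 : ℝ) < (Fintype.card (Equiv.Perm (Fin m)) : ℝ) := by
    exact_mod_cast Fintype.card_pos
  have hW0 : ∀ ω, 0 ≤ W ω := fun ω =>
    mul_nonneg (inv_nonneg.2 hM.le) (Finset.sum_nonneg fun π _ => hΦ0 _)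
  have hWle : ∀ ω, W ω ≤ Fintype.card (Fin n × Fin h) * 1 := fun ω => by
    simp only [hW]
    rw [inv_mul_le_iff₀ hM]
    refine (Finset.sum_le_sum fun π _ => hΦle (permPair X π ω)).trans ?_
    simp
  have hexpint : ∀ {Y : Ω → ℝ}, Measurable Y → (∀ ω, 0 ≤ Y ω) →
      (∀ ω, Y ω ≤ Fintype.card (Fin n × Fin h) * 1) → ∀ t,
      Integrable (fun ω => Real.exp (t * Y ω)) P := by
    intro Y hY hY0 hY1 t
    refine .of_mem_Icc 0 (Real.exp (|t| * (Fintype.card (Fin n × Fin h) * 1)))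
      (hY.const_mul t).exp.aemeasurable
      (.of_forall fun ω => ⟨(Real.exp_pos _).le, Real.exp_le_exp.2 ?_⟩)
    exact (mul_le_mul_of_nonneg_right (le_abs_self t) (hY0 ω)).trans
      (mul_le_mul_of_nonneg_left (hY1 ω) (abs_nonneg t))
  have hmapint : ∀ π {ψ : (Fin n × Fin h → S × S) → ℝ}, Measurable ψ →
      ∫ ω, ψ (permPair X π ω) ∂P = ∫ y, ψ y ∂Measure.pi ν := by
    intro π ψ hψ
    rw [← map_permPair P μ hX_meas hX_indep hlaw π,
      integral_map (measurable_permPair hX_meas π).aemeasurable hψ.aestronglyMeasurable]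
  have hmgfW : ∀ t, 0 < t → t < 1 → ∫ ω, Real.exp (t * W ω) ∂P
      ≤ Real.exp ((t * e + t ^ 2 * V / 2) / (1 - t)) := by
    intro t ht0 ht1
    refine integral_exp_average_le P (Y := fun π ω => Φ (permPair X π ω))
      (fun π => hexpint (hYm π) (fun ω => hΦ0 _) (fun ω => hΦle _) t)
      (hexpint hWm hW0 hWle t) fun π => ?_
    rw [hmapint π (hΦm.const_mul t).exp]
    exact hmgfΦ t ht0 ht1
  have hsplit : ∫ ω', splitSup F X ω' / ((n : ℝ) * (h : ℝ)) ∂P = U / (n * h) * e := by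
    simp only [splitSup_eq F hU0 X]
    rw [integral_div, integral_const_mul, hmapint 1 hΦm]
    ring
  have hsqrt : Real.sqrt (2 * σ ^ 2 / ((n : ℝ) * (h : ℝ)) * x)
      = U / (n * h) * Real.sqrt (2 * V * x) := by
    have : 2 * σ ^ 2 / ((n : ℝ) * (h : ℝ)) * x = (U / (n * h)) ^ 2 * (2 * V * x) := by
      rw [hV]; field_simp
    rw [this, Real.sqrt_mul (sq_nonneg _), Real.sqrt_sq (by positivity)]
  refine (one_sub_exp_neg_le_measureReal_le P he0 (by positivity : 0 ≤ V) hx hα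
    (hexpint hWm hW0 hWle) hmgfW).trans (measureReal_mono fun ω hω => ?_)
  simp only [Set.mem_ofPred_eq] at hω ⊢
  rw [hsplit, hsqrt]
  have hc : (0 : ℝ) < U / (n * h) := by positivity
  have h1 := mul_le_mul_of_nonneg_left hω hc.le
  have h2 : 1 / ((n : ℝ) * (m : ℝ) * ((m : ℝ) - 1)) * uStatSup F X ω ≤ U / (n * h) * W ω := by
    have h3 := uStatSup_le ⟨f₀, hf₀⟩ hU0 hU X ω
    have hm0 : (0 : ℝ) < (m : ℝ) - 1 := by linarith
    have hmp : (0 : ℝ) < (m : ℝ) := by linarith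
    rw [one_div_mul_eq_div, div_mul_eq_mul_div, div_le_div_iff₀ (by positivity) (by positivity)]
    have h4 := mul_le_mul_of_nonneg_left h3 hnpos.le
    simp only [hW]
    linarith
  refine h2.trans (h1.trans (le_of_eq ?_))
  field_simp
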